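/- Let $\tau\in(2,3)$, $\gamma\in(0,1)$, $C>0$, and let $F$ be the distribution function of a law on $\{0,1,2,\dots\}$ with $F(1)=0$ and $$x^{-\tau+1-C(\log x)^{\gamma-1}}\le 1-F(x)\le x^{-\tau+1+C(\log x)^{\gamma-1}}\qquad\text{for all } x>1.$$ Let $p:\mathbb N\to[0,1]$ be non-increasing, and suppose that for some constants $b,c>0$ and $\kappa<1$ we have $p(d)>b\exp\{-c(\log d)^{\kappa}\}$ for all integers $d\ge2$. For $n\ge1$ let $d_1,\dots,d_n$ be i.i.d. with distribution function $F$; if $\sum_i d_i$ is odd, increase $d_n$ by one. Give vertex $i\in[n]$ exactly $d_i$ half-edges. In degree-dependent half-edge percolation on the configuration model, each half-edge at a vertex of degree $d$ is, independently, kept with probability $p(d)$ and otherwise moved to a new artificial vertex of degree one; then all half-edges are paired uniformly at random and the artificial vertices are removed, so that exactly the edges formed by two kept half-edges remain. Let $\mathcal D^{rr}_n(u,v)\in\{0,1,2,\dots\}\cup\{\infty\}$ be the graph distance in the resulting graph on $[n]$ ($\infty$ if $u,v$ are not connected). Let $u,v$ be independent uniform vertices of $[n]$, independent of everything else. Then for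 every $\varepsilon>0$ there is $k=k(\varepsilon)$ (which may also depend on $F$ and $p$, but not on $n$) such that $$\sup_{n\ge3}\ \mathbb P\Big(\mathcal D^{rr}_n(u,v)-\frac{2\log\log n}{|\log(\tau-2)|}\ge1\ \Big|\ d_u\ge k,\ d_v\ge k\Big)<\varepsilon .$$ With the same $k$, the same bound holds for the graph distance in degree-dependent edge percolation, in which all half-edges are first paired uniformly at random and then each edge formed between vertices $x$ and $y$ is, independently, kept with probability $p(d_x)p(d_y)$. -/

import Mathlib

open MeasureTheory ProbabilityTheory
open scoped ENNReal

namespace ConfigModel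

/-- The degree sequence used for the pairing: if the total degree is odd, one half-edge is added to
the last vertex, so that the total number of half-edges is even. -/
def evenDegrees {n : ℕ} (d : Fin n → ℕ) : Fin n → ℕ := fun i =>
  if Odd (∑ j, d j) ∧ (i : ℕ) + 1 = n then d i + 1 else d i

/-- The half-edges: vertex `i` carries `d i` of them, and `s.1` is the vertex of the half-edge `s`. -/
abbrev HalfEdge {n : ℕ} (d : Fin n → ℕ) : Type := Σ i : Fin n, Fin (d i)

/-- A pairing (perfect matching) of `H`: every `s` is paired to `σ s ≠ s`. -/
def Pairing (H : Type) : Type := {σ : Equiv.Perm H // ∀ s, σ s ≠ s ∧ σ (σ s) = s}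

instance (H : Type) : MeasurableSpace (Pairing H) := ⊤

/-- The uniform law on the pairings of `H`. -/
noncomputable def uniformPairing (H : Type) : Measure (Pairing H) := uniformOn Set.univ

/-- The graph that keeps, among the edges `{s, σ s}` formed by the pairing `σ`, those that are
`retained`. Loops and multiplicities are forgotten, as they play no role for graph distances. -/
def pairedGraph {n : ℕ} {d : Fin n → ℕ} (σ : Pairing (HalfEdge d))
    (retained : Sym2 (HalfEdge d) → Prop) : SimpleGraph (Fin n) where
  Adj u v := u ≠ v ∧ ∃ s : HalfEdge d, s.1 = u ∧ (σ.1 s).1 = v ∧ retained s(s, σ.1 s)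
  symm := ⟨by
    rintro u v ⟨huv, s, hs, ht, hr⟩
    refine ⟨huv.symm, σ.1 s, ht, ?_, ?_⟩
    · rw [(σ.2 s).2, hs]
    · rwa [(σ.2 s).2, Sym2.eq_swap]⟩
  loopless := ⟨fun _ h => h.1 rfl⟩

/-- Degree-dependent half-edge percolation on the configuration model with degree sequence `d`
(with even total): independently, every half-edge `s` is kept (`keep s = true`) with probability
`p (d s.1)` and otherwise moved to an artificial vertex of degree one. All half-edges are paired
uniformly at random, and the artificial vertices are removed: the edges that remain are those both
of whose half-edges were kept. -/
noncomputable def halfEdgePercolation (p : ℕ → unitInterval) {n : ℕ} (d : Fin n → ℕ) :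
    Measure (SimpleGraph (Fin n)) :=
  ((uniformPairing (HalfEdge d)).prod
      (Measure.pi fun s : HalfEdge d => bernoulliMeasure true false (p (d s.1)))).map
    fun ω => pairedGraph ω.1 fun e => ∀ s ∈ e, ω.2 s = true

/-- Degree-dependent edge percolation on the configuration model with degree sequence `d`
(with even total): the half-edges are paired uniformly at random and then, independently, every edge
`{s, t}` that was formed is kept with probability `p (d s.1) * p (d t.1)`. -/
noncomputable def edgePercolation (p : ℕ → unitInterval) {n : ℕ} (d : Fin n → ℕ) :
    Measure (SimpleGraph (Fin n)) :=
  ((uniformPairing (HalfEdge d)).prod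
      (Measure.pi fun e : Sym2 (HalfEdge d) =>
        bernoulliMeasure true false (e.map fun s => p (d s.1)).mul)).map
    fun ω => pairedGraph ω.1 fun e => ω.2 e = true

/-- The joint law of the degree sequence, the random graph and two vertices `u, v`. The degrees are
i.i.d. with law `μ` (up to the parity correction); given the degrees `d`, the graph has the law
`graphLaw d`; the vertices are independent of each other and of everything else, and uniform. -/
noncomputable def jointLaw (μ : Measure ℕ) (n : ℕ)
    (graphLaw : (Fin n → ℕ) → Measure (SimpleGraph (Fin n))) :
    Measure (((Fin n → ℕ) × SimpleGraph (Fin n)) × (Fin n × Fin n)) :=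
  (((Measure.pi fun _ : Fin n => μ).map evenDegrees) ⊗ₘ Kernel.ofFunOfCountable graphLaw).prod
    (uniformOn Set.univ)

/-- The event `d_u ≥ k, d_v ≥ k`. -/
def highDegrees (n k : ℕ) : Set (((Fin n → ℕ) × SimpleGraph (Fin n)) × (Fin n × Fin n)) :=
  {ω | k ≤ ω.1.1 ω.2.1 ∧ k ≤ ω.1.1 ω.2.2}

/-- The event `D(u, v) - 2 log log n / |log (τ - 2)| ≥ 1`, where `D` is the graph distance, with
`D(u, v) = ∞` if `u` and `v` are not connected. -/
def farApart (τ : ℝ) (n : ℕ) : Set (((Fin n → ℕ) × SimpleGraph (Fin n)) × (Fin n × Fin n)) :=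
  {ω | (1 : EReal) ≤ (((ω.1.2.edist ω.2.1 ω.2.2 : ℕ∞) : ℝ≥0∞) : EReal)
        - ((2 * Real.log (Real.log n) / |Real.log (τ - 2)| : ℝ) : EReal)}

/-- The distribution function of a law on `ℕ`. -/
noncomputable def distrib (μ : Measure ℕ) (x : ℝ) : ℝ := μ.real {d : ℕ | (d : ℝ) ≤ x}

end ConfigModel

/-! Fix the degrees first. A uniform pairing can be revealed edge by edge: whatever closed set of
half-edges is already known, a fresh half-edge `s` meets a given fresh `t` with probability at least
`1 / |H|`, and the edge then survives with probability `p(d_s) p(d_t)`, independently of the past.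
Both percolations have this property (`IndependentRetention`, `Explorable`), so one argument covers
both.

Put `θ = τ - 2`, `N = log n` and `g = max γ κ < 1`. A vertex of degree `e^x` has in mean `exp(x - θ
y)` retained edges to vertices of degree about `e^y`, up to factors `exp(O(y^g))` that absorb both
the error in the tail of the degrees and the percolation. Hence `y` can be nearly `x / θ` with
`exp(y^g)` edges to spare, and the step fails with probability of order `exp(-η exp(y^g))`. Starting
from degree `K`, such layers (`exists_layers`) reach degree `n^β` in `m < log N / |log θ|` steps,
with total failure probability small in `K`, uniformly in `n`. Here `1/2 < β < 1/(τ - 1)`: the upper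
bound keeps the layers populated, the lower one links any two vertices of the top layer directly.
Climbing from both `u` and `v` gives distance at most `2m + 1 < 1 + 2 log log n / |log θ|`
(`IsPercolationLaw.real_far_le`, `exists_real_far_le`).

If `n ≤ K^(5/4)` there is no room for layers, but then the total degree is typically of order at
most `K^(5/4)`, far below `K^2`, and `u`, `v` are linked directly (`exists_real_not_adjacent_le`).
That the degrees are typical follows from Markov (total degree) and Chebyshev (layer sizes), applied
to vertices other than `u` and `v`, hence independent of the conditioning. The parity correction
shifts the threshold `k` by at most one; this is harmless where the tail does not halve in one step
(`TailBounds.exists_le_two_mul`). -/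

namespace ConfigModel

/-! ### Revealing a random pairing edge by edge -/

section Exploration

variable {X H V : Type} [MeasurableSpace X] [DiscreteMeasurableSpace X] [Fintype H] [DecidableEq H]
  [DecidableEq V]

/-- The outcomes that agree with `x₀` on the partners and on the retention of the half-edges in
`R`. -/
def cylinder (σ : X → Pairing H) (ret : X → H → Prop) (R : Finset H) (x₀ : X) : Set X :=
  {x | ∀ s ∈ R, (σ x).1 s = (σ x₀).1 s ∧ (ret x s ↔ ret x₀ s)}

/-- The set `R` of half-edges is closed under the pairing `σ`. -/
def PairClosed (σ : Pairing H) (R : Finset H) : Prop := ∀ s ∈ R, σ.1 s ∈ R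

/-- A random pairing `σ` with retention `ret` can be explored with weights `w`: given any revealed
closed part, an unrevealed half-edge `s` forms a retained edge with an unrevealed `t` with
probability at least `w s t`. -/
structure Explorable (P : Measure X) (σ : X → Pairing H) (ret : X → H → Prop) (w : H → H → ℝ) :
    Prop where
  ret_partner : ∀ x s, ret x ((σ x).1 s) ↔ ret x s
  weight_le : ∀ (R : Finset H) (x₀ : X), PairClosed (σ x₀) R → ∀ s ∉ R, ∀ t ∉ R, s ≠ t →
    w s t * P.real (cylinder σ ret R x₀) ≤
      P.real (cylinder σ ret R x₀ ∩ {x | (σ x).1 s = t ∧ ret x s})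

omit [Fintype H] in
lemma pairClosed_insert {σ : Pairing H} {R : Finset H} (hR : PairClosed σ R) (s : H) :
    PairClosed σ (insert s (insert (σ.1 s) R)) := by
  intro a ha
  simp only [Finset.mem_insert] at ha ⊢
  rcases ha with rfl | rfl | ha
  · simp
  · simp [(σ.2 s).2]
  · exact Or.inr (Or.inr (hR a ha))

-- Knowing `s` also determines its partner: the pairing is an involution and both ends share the
-- retention status. So refining by one half-edge gives a cylinder over a closed set again, which
-- lets the exploration iterate.
omit [DiscreteMeasurableSpace X] [Fintype H] in
lemma cylinder_insert {P : Measure X} {σ : X → Pairing H} {ret : X → H → Prop} {w : H → H → ℝ}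
    (hE : Explorable P σ ret w) {R : Finset H} {x₀ x₁ : X} (hx : x₁ ∈ cylinder σ ret R x₀) (s : H) :
    cylinder σ ret (insert s (insert ((σ x₁).1 s) R)) x₁ =
      cylinder σ ret R x₀ ∩ {x | (σ x).1 s = (σ x₁).1 s ∧ (ret x s ↔ ret x₁ s)} := by
  ext x
  simp only [cylinder, Set.mem_ofPred_eq, Set.mem_inter_iff, Finset.mem_insert, forall_eq_or_imp]
  constructor
  · rintro ⟨h1, -, h3⟩
    exact ⟨fun a ha => ⟨(h3 a ha).1.trans (hx a ha).1, (h3 a ha).2.trans (hx a ha).2⟩, h1⟩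
  · rintro ⟨h3, h1⟩
    refine ⟨h1, ⟨?_, ?_⟩, fun a ha => ⟨(h3 a ha).1.trans (hx a ha).1.symm,
      (h3 a ha).2.trans (hx a ha).2.symm⟩⟩
    · rw [((σ x₁).2 s).2, ← h1.1, ((σ x).2 s).2]
    · rw [hE.ret_partner x₁ s, ← h1.1, hE.ret_partner x s]
      exact h1.2

omit [Fintype H] in
open Classical in
/-- A bound that holds on every refinement of a cylinder by the partner of `s` holds on unions of
such refinements. -/
lemma measureReal_le_of_refinements {P : Measure X} [IsFiniteMeasure P] {σ : X → Pairing H}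
    {ret : X → H → Prop} {w : H → H → ℝ} (hE : Explorable P σ ret w) {R : Finset H} {x₀ : X} (s : H)
    (B : Finset (H × Prop)) (F : Set X) (c : ℝ)
    (hc : ∀ x₁ ∈ cylinder σ ret R x₀, ((σ x₁).1 s, ret x₁ s) ∈ B →
      P.real (F ∩ cylinder σ ret (insert s (insert ((σ x₁).1 s) R)) x₁) ≤
        c * P.real (cylinder σ ret (insert s (insert ((σ x₁).1 s) R)) x₁)) :
    P.real (F ∩ (cylinder σ ret R x₀ ∩ {x | ((σ x).1 s, ret x s) ∈ B})) ≤
      c * P.real (cylinder σ ret R x₀ ∩ {x | ((σ x).1 s, ret x s) ∈ B}) := by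
  set key : X → H × Prop := fun x => ((σ x).1 s, ret x s) with hkey
  have hsum : ∀ A : Set X, P.real (A ∩ {x | key x ∈ B}) = ∑ b ∈ B, P.real (A ∩ key ⁻¹' {b}) := by
    intro A
    have : A ∩ {x | key x ∈ B} = ⋃ b ∈ B, A ∩ key ⁻¹' {b} := by
      ext x; simp
    rw [this, measureReal_biUnion_finset]
    · intro a _ b _ hab
      refine Set.disjoint_left.2 fun x hx hy => hab ?_
      exact hx.2.symm.trans hy.2
    · intro b _; exact MeasurableSet.of_discrete
  rw [← Set.inter_assoc, hsum, hsum, Finset.mul_sum]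
  refine Finset.sum_le_sum fun b hb => ?_
  by_cases hne : (cylinder σ ret R x₀ ∩ key ⁻¹' {b}).Nonempty
  · obtain ⟨x₁, hx₁, hk⟩ := hne
    have hk' : key x₁ = b := hk
    have := hc x₁ hx₁ (by have := hb; rw [← hk'] at this; exact this)
    rw [cylinder_insert hE hx₁ s] at this
    have he : {x | (σ x).1 s = (σ x₁).1 s ∧ (ret x s ↔ ret x₁ s)} = key ⁻¹' {b} := by
      ext x
      simp [← hk', hkey, Prod.ext_iff]
    rw [he, ← Set.inter_assoc] at this
    exact this
  · rw [Set.not_nonempty_iff_eq_empty] at hne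
    rw [Set.inter_assoc, hne]
    simp

/-- Revealing the partner of one half-edge `s`, which is a retained edge to the target `T` with
probability at least `q`. -/
lemma measureReal_reveal_le {P : Measure X} [IsFiniteMeasure P] {σ : X → Pairing H}
    {ret : X → H → Prop} {w : H → H → ℝ} (hE : Explorable P σ ret w) {R : Finset H} {x₀ : X}
    (hR : PairClosed (σ x₀) R) {s : H} (hs : s ∉ R) (T : Finset H) {q f g : ℝ}
    (hq : q ≤ ∑ t ∈ T \ insert s R, w s t) (hfg : f ≤ g) (F : Set X)
    (hf : ∀ x₁ ∈ cylinder σ ret R x₀, (σ x₁).1 s ∈ T → ret x₁ s →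
      P.real (F ∩ cylinder σ ret (insert s (insert ((σ x₁).1 s) R)) x₁) ≤
        f * P.real (cylinder σ ret (insert s (insert ((σ x₁).1 s) R)) x₁))
    (hg : ∀ x₁ ∈ cylinder σ ret R x₀,
      P.real (F ∩ cylinder σ ret (insert s (insert ((σ x₁).1 s) R)) x₁) ≤
        g * P.real (cylinder σ ret (insert s (insert ((σ x₁).1 s) R)) x₁)) :
    P.real (F ∩ cylinder σ ret R x₀) ≤ (q * f + (1 - q) * g) * P.real (cylinder σ ret R x₀) := by
  classical
  set C := cylinder σ ret R x₀ with hC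
  set B : Finset (H × Prop) := (T \ insert s R) ×ˢ {True} with hB
  set hit : Set X := {x | ((σ x).1 s, ret x s) ∈ B} with hhit
  have h1 := measureReal_le_of_refinements hE (x₀ := x₀) (R := R) s B F f (fun x₁ hx hb => by
    simp only [hB, Finset.mem_product, Finset.mem_sdiff, Finset.mem_singleton, eq_iff_iff,
      iff_true] at hb
    exact hf x₁ hx hb.1.1 hb.2)
  have h2 := measureReal_le_of_refinements hE (x₀ := x₀) (R := R) s Bᶜ F g
    (fun x₁ hx _ => hg x₁ hx)
  have hcompl : {x | ((σ x).1 s, ret x s) ∈ Bᶜ} = hitᶜ := by ext; simp [hhit]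
  rw [hcompl] at h2
  have h3 : P.real (C ∩ hit) + P.real (C ∩ hitᶜ) = P.real C := by
    rw [← Set.sdiff_eq]; exact measureReal_inter_add_sdiff MeasurableSet.of_discrete
  have h4 : P.real (F ∩ (C ∩ hit)) + P.real (F ∩ (C ∩ hitᶜ)) = P.real (F ∩ C) := by
    rw [← Set.inter_assoc, ← Set.inter_assoc, ← Set.sdiff_eq]
    exact measureReal_inter_add_sdiff MeasurableSet.of_discrete
  -- Different partners `t` give disjoint events, so their weights add up to at least `q`.
  have h5 : q * P.real C ≤ P.real (C ∩ hit) := by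
    have : C ∩ hit = ⋃ t ∈ T \ insert s R, C ∩ {x | (σ x).1 s = t ∧ ret x s} := by
      ext x; simp [hhit, hB]
    rw [this, measureReal_biUnion_finset]
    · calc q * P.real C ≤ (∑ t ∈ T \ insert s R, w s t) * P.real C := by gcongr
        _ = ∑ t ∈ T \ insert s R, w s t * P.real C := Finset.sum_mul ..
        _ ≤ _ := by
          refine Finset.sum_le_sum fun t ht => ?_
          simp only [Finset.mem_sdiff, Finset.mem_insert, not_or] at ht
          exact hE.weight_le R x₀ hR s hs t ht.2.2 (Ne.symm ht.2.1)
    · intro a _ b _ hab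
      refine Set.disjoint_left.2 fun x hx hy => hab ?_
      exact hx.2.1.symm.trans hy.2.1
    · intro b _; exact MeasurableSet.of_discrete
  have h1' : P.real (F ∩ (C ∩ hit)) ≤ f * P.real (C ∩ hit) := h1
  have h2' : P.real (F ∩ (C ∩ hitᶜ)) ≤ g * P.real (C ∩ hitᶜ) := h2
  have h6 : (g - f) * (q * P.real C) ≤ (g - f) * P.real (C ∩ hit) :=
    mul_le_mul_of_nonneg_left h5 (sub_nonneg.2 hfg)
  calc P.real (F ∩ C) ≤ f * P.real (C ∩ hit) + g * P.real (C ∩ hitᶜ) := by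
        rw [← h4]; exact add_le_add h1' h2'
    _ = g * P.real C - (g - f) * P.real (C ∩ hit) := by rw [← h3]; ring
    _ ≤ g * P.real C - (g - f) * (q * P.real C) := by gcongr
    _ = (q * f + (1 - q) * g) * P.real C := by ring

/-- Revealing up to `j` half-edges of `A`, one by one, until one of them forms a retained edge to
the target `T`. -/
lemma measureReal_search_le {P : Measure X} [IsFiniteMeasure P] {σ : X → Pairing H}
    {ret : X → H → Prop} {w : H → H → ℝ} (hE : Explorable P σ ret w) (A T : Finset H) {q f : ℝ}
    {r : ℕ} (hq1 : q ≤ 1) (hA : r ≤ A.card)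
    (hq : ∀ R : Finset H, R.card < r → ∀ s ∈ A, q ≤ ∑ t ∈ T \ insert s R, w s t) (F : Set X)
    (hF : ∀ (R : Finset H) (x₁ : X), PairClosed (σ x₁) R → R.card ≤ r →
      (∃ s ∈ A, s ∈ R ∧ (σ x₁).1 s ∈ T ∧ ret x₁ s) →
        P.real (F ∩ cylinder σ ret R x₁) ≤ f * P.real (cylinder σ ret R x₁)) (hf : 0 ≤ f) (j : ℕ) :
    ∀ (R : Finset H) (x₀ : X), PairClosed (σ x₀) R → R.card + 2 * j ≤ r →
      P.real (F ∩ cylinder σ ret R x₀) ≤ (f + (1 - q) ^ j) * P.real (cylinder σ ret R x₀) := by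
  have hq0 : 0 ≤ 1 - q := by linarith
  induction j with
  | zero =>
    intro R x₀ _ _
    -- With no trial left, `(1 - q) ^ 0 = 1` is the trivial bound.
    have : P.real (F ∩ cylinder σ ret R x₀) ≤ P.real (cylinder σ ret R x₀) :=
      measureReal_mono Set.inter_subset_right
    have h0 : 0 ≤ f * P.real (cylinder σ ret R x₀) := by positivity
    simp only [pow_zero]
    linarith
  | succ j ih =>
    intro R x₀ hR hcard
    have hlt : R.card < r := by omega
    obtain ⟨s, hsA, hsR⟩ : ∃ s ∈ A, s ∉ R := by
      by_contra! h
      have := Finset.card_le_card (s := A) (t := R) h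
      omega
    have hcl : ∀ x₁ ∈ cylinder σ ret R x₀, PairClosed (σ x₁) R := by
      intro x₁ hx a ha
      rw [(hx a ha).1]
      exact hR a ha
    have hcard' : ∀ x₁, (insert s (insert ((σ x₁).1 s) R)).card ≤ R.card + 2 := by
      intro x₁
      exact (Finset.card_insert_le _ _).trans (Nat.succ_le_succ (Finset.card_insert_le _ _))
    have := measureReal_reveal_le hE hR hsR T (f := f) (g := f + (1 - q) ^ j) (hq R hlt s hsA)
      (by have := pow_nonneg hq0 j; linarith) F ?_ ?_
    -- The recursion is `q f + (1 - q)(f + (1 - q)^j) = f + (1 - q)^(j+1)`.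
    · refine this.trans (mul_le_mul_of_nonneg_right ?_ measureReal_nonneg)
      rw [pow_succ]
      ring_nf
      rfl
    · intro x₁ hx hT hr
      refine hF _ x₁ (pairClosed_insert (hcl x₁ hx) s) ((hcard' x₁).trans (by omega))
        ⟨s, hsA, by simp, hT, hr⟩
    · intro x₁ hx
      refine ih _ x₁ (pairClosed_insert (hcl x₁ hx) s) ?_
      have := hcard' x₁
      omega

/-- From `v` in layer `i` one can climb `j` more layers along retained edges. -/
def Climbs (vert : H → V) (G : ℕ → Finset V) (σ : Pairing H) (ret : H → Prop) : ℕ → ℕ → V → Prop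
  | 0, _, _ => True
  | j + 1, i, v => ∃ s, vert s = v ∧ ret s ∧ vert (σ.1 s) ∈ G (i + 1) ∧
      Climbs vert G σ ret j (i + 1) (vert (σ.1 s))

/-- The search is run once per layer. `r i` bounds the half-edges revealed on arrival in layer `i`,
`t i` is the number of trials there, and each trial reveals two half-edges. Layer `i` fails with
probability at most `(1 - q i) ^ t i`, and the failures are summed. -/
lemma measureReal_not_climbs_le {P : Measure X} [IsFiniteMeasure P] {σ : X → Pairing H}
    {ret : X → H → Prop} {w : H → H → ℝ} (hE : Explorable P σ ret w) (vert : H → V)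
    (G : ℕ → Finset V) (m : ℕ) (r t : ℕ → ℕ) (q : ℕ → ℝ)
    (hr : ∀ i < m, r i + 2 * t i ≤ r (i + 1))
    (hq1 : ∀ i < m, q i ≤ 1)
    (hdeg : ∀ i < m, ∀ v ∈ G i, r (i + 1) ≤ ({s | vert s = v} : Finset H).card)
    (hq : ∀ i < m, ∀ v ∈ G i, ∀ R : Finset H, R.card < r (i + 1) → ∀ s, vert s = v →
      q i ≤ ∑ t ∈ ({s | vert s ∈ G (i + 1)} : Finset H) \ insert s R, w s t) (j : ℕ) :
    ∀ i, i + j ≤ m → ∀ v ∈ G i, ∀ (R : Finset H) (x₀ : X), PairClosed (σ x₀) R → R.card ≤ r i →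
      P.real ({x | ¬ Climbs vert G (σ x) (ret x) j i v} ∩ cylinder σ ret R x₀) ≤
        (∑ l ∈ Finset.range j, (1 - q (i + l)) ^ t (i + l)) * P.real (cylinder σ ret R x₀) := by
  induction j with
  | zero =>
    intro i _ v _ R x₀ _ _
    simp [Climbs]
  | succ j ih =>
    intro i hi v hv R x₀ hR hcard
    rw [Finset.sum_range_succ', add_zero]
    have him : i < m := by omega
    have hnn : ∀ l ∈ Finset.range j, 0 ≤ (1 - q (i + (l + 1))) ^ t (i + (l + 1)) := by
      intro l hl
      have := Finset.mem_range.1 hl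
      have := hq1 (i + (l + 1)) (by omega)
      exact pow_nonneg (by linarith) _
    refine measureReal_search_le hE ({s | vert s = v} : Finset H)
      ({s | vert s ∈ G (i + 1)} : Finset H) (r := r (i + 1)) (hq1 i him) (hdeg i him v hv)
      (fun R hR s hs => hq i him v hv R hR s (by simpa using hs)) _ ?_ (Finset.sum_nonneg hnn)
      (t i) R x₀ hR ((Nat.add_le_add_right hcard _).trans (hr i him))
    rintro R' x₁ hR' hcard' ⟨s, hsv, hsR, hsT, hret⟩
    simp only [Finset.mem_filter, Finset.mem_univ, true_and] at hsv hsT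
    have := ih (i + 1) (by omega) _ hsT R' x₁ hR' hcard'
    simp only [add_assoc, add_comm 1] at this
    refine le_trans (measureReal_mono ?_) this
    rintro x ⟨hx, hxc⟩
    -- The edge at `s` is constant on the cylinder, so a climb from its far end would extend to a
    -- climb from `v`.
    refine ⟨fun hcl => hx ⟨s, hsv, ?_, ?_, ?_⟩, hxc⟩
    · exact (hxc s hsR).2.2 hret
    · rw [(hxc s hsR).1]; exact hsT
    · rw [(hxc s hsR).1, add_comm i 1]; simpa only [add_comm] using hcl

end Exploration

/-! ### Independence under product measures -/

section ProductMeasure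

variable {ι Y : Type} [Fintype ι] [MeasurableSpace Y] [Countable Y] [MeasurableSingletonClass Y]

/-- Under a product measure, events that depend on disjoint sets of coordinates are independent. -/
lemma pi_real_inter_of_disjoint (ν : ι → Measure Y) [∀ i, IsProbabilityMeasure (ν i)]
    {S T : Finset ι} (hST : Disjoint S T) {A B : Set (ι → Y)}
    (hA : ∀ x y : ι → Y, (∀ i ∈ S, x i = y i) → x ∈ A → y ∈ A)
    (hB : ∀ x y : ι → Y, (∀ i ∈ T, x i = y i) → x ∈ B → y ∈ B) :
    (Measure.pi ν).real (A ∩ B) = (Measure.pi ν).real A * (Measure.pi ν).real B := by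
  have hind : iIndepFun (fun i (x : ι → Y) => x i) (Measure.pi ν) :=
    iIndepFun_pi (X := fun _ => id) fun i => aemeasurable_id
  have h := hind.indepFun_finset S T hST (fun i => measurable_pi_apply i)
  have key : ∀ (U : Finset ι) (D : Set (ι → Y)),
      (∀ x y : ι → Y, (∀ i ∈ U, x i = y i) → x ∈ D → y ∈ D) →
      (fun (x : ι → Y) (i : U) => x i) ⁻¹' ((fun (x : ι → Y) (i : U) => x i) '' D) = D := by
    intro U D hD
    refine Set.Subset.antisymm ?_ (Set.subset_preimage_image _ _)
    rintro y ⟨x, hx, hxy⟩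
    exact hD x y (fun i hi => congrFun hxy ⟨i, hi⟩) hx
  have := h.measure_inter_preimage_eq_mul _ _
    (Set.to_countable ((fun (x : ι → Y) (i : S) => x i) '' A)).measurableSet
    (Set.to_countable ((fun (x : ι → Y) (i : T) => x i) '' B)).measurableSet
  rw [key S A hA, key T B hB] at this
  simp [measureReal_def, this]

end ProductMeasure

/-! ### Uniform pairings and the two kinds of retention -/

section UniformPairing

variable {H : Type} [Fintype H] [DecidableEq H]

instance : Finite (Pairing H) := inferInstanceAs (Finite {_σ : Equiv.Perm H // _})

noncomputable instance : Fintype (Pairing H) := Fintype.ofFinite _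

instance : DiscreteMeasurableSpace (Pairing H) := ⟨fun _ => trivial⟩

/-- Exchanging the roles of two half-edges in a pairing. -/
def Pairing.relabel (f : Equiv.Perm H) (σ : Pairing H) : Pairing H :=
  ⟨f * σ.1 * f⁻¹, fun s => by
    refine ⟨fun h => (σ.2 (f⁻¹ s)).1 ?_, ?_⟩
    · simp only [Equiv.Perm.mul_apply] at h
      rw [Equiv.Perm.eq_inv_iff_eq]; exact h
    · simp [Equiv.Perm.mul_apply, (σ.2 _).2]⟩

omit [Fintype H] [DecidableEq H] in
lemma Pairing.relabel_injective (f : Equiv.Perm H) :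
    Function.Injective (Pairing.relabel f : Pairing H → Pairing H) := by
  intro σ τ h
  have := congrArg Subtype.val h
  exact Subtype.ext (by simpa [Pairing.relabel] using this)

-- Conjugation by the transposition of `t` and `t'` injects the pairings with `σ s = t'` into those
-- with `σ s = t` without touching `R`. Summing over the possible partners `t'` gives the factor
-- `|H|`, that is, conditional probability at least `1 / |H|`.
open Classical in
lemma card_agreeing_le {R : Finset H} {σ₀ : Pairing H} (hR : PairClosed σ₀ R) {s t : H}
    (hs : s ∉ R) (ht : t ∉ R) (hst : s ≠ t) :
    ({σ : Pairing H | ∀ a ∈ R, σ.1 a = σ₀.1 a} : Finset _).card ≤ Fintype.card H *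
      ({σ : Pairing H | (∀ a ∈ R, σ.1 a = σ₀.1 a) ∧ σ.1 s = t} : Finset _).card := by
  rw [Finset.card_eq_sum_card_fiberwise (f := fun σ : Pairing H => σ.1 s) (t := Finset.univ)
    (fun _ _ => Finset.mem_coe.2 (Finset.mem_univ _)), ← Finset.card_univ, ← smul_eq_mul]
  refine Finset.sum_le_card_nsmul _ _ _ fun t' _ => ?_
  rw [Finset.filter_filter]
  refine Finset.card_le_card_of_injOn (Pairing.relabel (Equiv.swap t t')) ?_
    (Pairing.relabel_injective _).injOn
  intro σ hσ
  simp only [Finset.coe_filter, Finset.mem_univ, true_and, Set.mem_ofPred_eq] at hσ ⊢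
  obtain ⟨hσ, hst'⟩ := hσ
  have ht' : t' ∉ R := by
    intro h
    apply hs
    have h1 : σ.1 t' = s := by rw [← hst', (σ.2 s).2]
    rw [← h1, hσ t' h]
    exact hR t' h
  have hst'' : s ≠ t' := by rw [← hst']; exact (σ.2 s).1.symm
  constructor
  · intro a ha
    have h1 : a ≠ t := fun h => ht (h ▸ ha)
    have h2 : a ≠ t' := fun h => ht' (h ▸ ha)
    have h3 : σ₀.1 a ≠ t := fun h => ht (h ▸ hR a ha)
    have h4 : σ₀.1 a ≠ t' := fun h => ht' (h ▸ hR a ha)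
    simp [Pairing.relabel, Equiv.swap_apply_of_ne_of_ne h1 h2, hσ a ha,
      Equiv.swap_apply_of_ne_of_ne h3 h4]
  · simp [Pairing.relabel, Equiv.swap_apply_of_ne_of_ne hst hst'', hst']

omit [DecidableEq H] in
lemma uniformPairing_prod_real {Ω : Type} [MeasurableSpace Ω] [DiscreteMeasurableSpace Ω]
    [Finite Ω] (π : Measure Ω) [IsProbabilityMeasure π] (S : Set (Pairing H × Ω)) :
    ((uniformPairing H).prod π).real S =
      (∑ σ : Pairing H, π.real {ω | (σ, ω) ∈ S}) / Fintype.card (Pairing H) := by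
  have : ((uniformPairing H).prod π) S =
      (∑ σ : Pairing H, π {ω | (σ, ω) ∈ S}) / Fintype.card (Pairing H) := by
    rw [Measure.prod_apply MeasurableSet.of_discrete, uniformPairing, uniformOn, ProbabilityTheory.cond]
    simp [lintegral_count, tsum_fintype, ENNReal.div_eq_inv_mul, Set.preimage]
  rw [measureReal_def, this, ENNReal.toReal_div, ENNReal.toReal_sum (by simp)]
  simp [measureReal_def]

/-- The retention `kept e` of the possible edges `e` is such that an edge `{s, t}` is retained with
probability `p s * p t`, independently of any set of edges that do not touch `s` and `t`. -/
structure IndependentRetention {Ω : Type} [MeasurableSpace Ω] (π : Measure Ω)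
    (kept : Sym2 H → Ω → Prop) (p : H → ℝ) : Prop where
  real_inter : ∀ (E : Finset (Sym2 H)) (s t : H), s ≠ t → (∀ e ∈ E, s ∉ e ∧ t ∉ e) →
    ∀ ρ : Sym2 H → Prop, π.real ({ω | ∀ e ∈ E, kept e ω ↔ ρ e} ∩ {ω | kept s(s, t) ω}) =
      π.real {ω | ∀ e ∈ E, kept e ω ↔ ρ e} * (p s * p t)

lemma IndependentRetention.explorable {Ω : Type} [MeasurableSpace Ω] [DiscreteMeasurableSpace Ω]
    [Finite Ω] {π : Measure Ω} [IsProbabilityMeasure π] {kept : Sym2 H → Ω → Prop} {p : H → ℝ}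
    (h : IndependentRetention π kept p) (hp : ∀ s, 0 ≤ p s) :
    Explorable ((uniformPairing H).prod π) (fun x => x.1) (fun x s => kept s(s, x.1.1 s) x.2)
      (fun s t => p s * p t / Fintype.card H) where
  ret_partner x s := by rw [(x.1.2 s).2, Sym2.eq_swap]
  weight_le := by
    classical
    rintro R ⟨σ₀, ω₀⟩ hR s hs t ht hst
    -- The cylinder restricts retention only on the edges of `σ₀` inside `R`; as `R` is closed, none
    -- of them touches `s` or `t`.
    set E : Finset (Sym2 H) := R.image fun a => s(a, σ₀.1 a) with hE
    set c : ℝ := π.real {ω | ∀ e ∈ E, kept e ω ↔ kept e ω₀} with hc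
    have hEst : ∀ e ∈ E, s ∉ e ∧ t ∉ e := by
      intro e he
      obtain ⟨a, ha, rfl⟩ := Finset.mem_image.1 he
      have := hR a ha
      simp only [Sym2.mem_iff, not_or]
      refine ⟨⟨?_, ?_⟩, ?_, ?_⟩ <;> rintro rfl <;> contradiction
    have hind := h.real_inter E s t hst hEst (fun e => kept e ω₀)
    rw [← hc] at hind
    have hset : ∀ σ : Pairing H, (∀ a ∈ R, σ.1 a = σ₀.1 a) →
        {ω | (σ, ω) ∈ cylinder (fun x : Pairing H × Ω => x.1)
          (fun x s => kept s(s, x.1.1 s) x.2) R (σ₀, ω₀)} =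
          {ω | ∀ e ∈ E, kept e ω ↔ kept e ω₀} := by
      intro σ hσ
      ext ω
      simp only [cylinder, Set.mem_ofPred_eq, hE, Finset.mem_image, forall_exists_index, and_imp,
        forall_apply_eq_imp_iff₂]
      constructor
      · intro h a ha
        have := (h a ha).2
        rwa [hσ a ha] at this
      · intro h a ha
        refine ⟨hσ a ha, ?_⟩
        rw [hσ a ha]
        exact h a ha
    rw [uniformPairing_prod_real, uniformPairing_prod_real]
    have h1 : ∑ σ : Pairing H, π.real {ω | (σ, ω) ∈ cylinder (fun x : Pairing H × Ω => x.1)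
          (fun x s => kept s(s, x.1.1 s) x.2) R (σ₀, ω₀)} ≤
        ({σ : Pairing H | ∀ a ∈ R, σ.1 a = σ₀.1 a} : Finset _).card * c := by
      rw [← nsmul_eq_mul, ← Finset.sum_const, Finset.sum_filter]
      refine Finset.sum_le_sum fun σ _ => ?_
      split_ifs with hσ
      · rw [hset σ hσ]
      · have : {ω | (σ, ω) ∈ cylinder (fun x : Pairing H × Ω => x.1)
          (fun x s => kept s(s, x.1.1 s) x.2) R (σ₀, ω₀)} = ∅ := by
          ext ω
          simp only [Set.mem_ofPred_eq, Set.mem_empty_iff_false, iff_false]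
          exact fun hx => hσ fun a ha => (hx a ha).1
        rw [this]; simp
    have h2 : ({σ : Pairing H | (∀ a ∈ R, σ.1 a = σ₀.1 a) ∧ σ.1 s = t} : Finset _).card *
        (c * (p s * p t)) ≤
        ∑ σ : Pairing H, π.real {ω | (σ, ω) ∈ cylinder (fun x : Pairing H × Ω => x.1)
          (fun x s => kept s(s, x.1.1 s) x.2) R (σ₀, ω₀) ∩
            {x | x.1.1 s = t ∧ kept s(s, x.1.1 s) x.2}} := by
      rw [← nsmul_eq_mul, ← Finset.sum_const, Finset.sum_filter]
      refine Finset.sum_le_sum fun σ _ => ?_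
      split_ifs with hσ
      · rw [← hind, ← hset σ hσ.1]
        refine measureReal_mono ?_
        rintro ω ⟨hω, hk⟩
        refine ⟨hω, hσ.2, ?_⟩
        simp only [hσ.2]; exact hk
      · positivity
    have h3 : (({σ : Pairing H | ∀ a ∈ R, σ.1 a = σ₀.1 a} : Finset _).card : ℝ) ≤
        Fintype.card H *
        ({σ : Pairing H | (∀ a ∈ R, σ.1 a = σ₀.1 a) ∧ σ.1 s = t} : Finset _).card := by
      exact_mod_cast card_agreeing_le hR hs ht hst
    have hH : (0 : ℝ) < Fintype.card H := by
      exact_mod_cast Fintype.card_pos_iff.2 ⟨s⟩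
    have hpp : 0 ≤ p s * p t := mul_nonneg (hp s) (hp t)
    have hc0 : 0 ≤ c := measureReal_nonneg
    rw [← mul_div_assoc]
    refine div_le_div_of_nonneg_right ?_ (by positivity)
    calc _ ≤ p s * p t / Fintype.card H * ((Fintype.card H *
        ({σ : Pairing H | (∀ a ∈ R, σ.1 a = σ₀.1 a) ∧ σ.1 s = t} : Finset _).card) * c) := by
          gcongr
          exact h1.trans (by gcongr)
      _ = ({σ : Pairing H | (∀ a ∈ R, σ.1 a = σ₀.1 a) ∧ σ.1 s = t} : Finset _).card *
        (c * (p s * p t)) := by field_simp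
      _ ≤ _ := h2

/-- The retention in half-edge percolation. -/
lemma independentRetention_halfEdge (p : H → unitInterval) :
    IndependentRetention (Measure.pi fun s : H => bernoulliMeasure true false (p s))
      (fun e ω => ∀ s ∈ e, ω s = true) (fun s => (p s : ℝ)) where
  real_inter E s t hst hE ρ := by
    classical
    rw [pi_real_inter_of_disjoint _ (S := ({s, t} : Finset H)ᶜ) (T := {s, t}) disjoint_compl_left]
    · congr 1
      have : {ω : H → Bool | ∀ a ∈ s(s, t), ω a = true} =
          {ω | ω s = true} ∩ {ω | ω t = true} := by
        ext ω; simp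
      rw [this, pi_real_inter_of_disjoint _ (S := {s}) (T := {t}) (by simpa using hst)]
      · have h1 : ∀ a, (Measure.pi fun s : H => bernoulliMeasure true false (p s)).real
            {ω : H → Bool | ω a = true} = p a := by
          intro a
          have := (measurePreserving_eval (fun s : H => bernoulliMeasure true false (p s)) a)
          have h2 := this.measureReal_preimage (s := {true}) (MeasurableSet.nullMeasurableSet
            MeasurableSet.of_discrete)
          have h3 : (Function.eval a ⁻¹' ({true} : Set Bool) : Set (H → Bool)) = {ω : H → Bool | ω a = true} := by ext; simp
          rw [h3] at h2
          rw [h2, bernoulliMeasure_real_apply _ MeasurableSet.of_discrete]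
          simp
        rw [h1, h1]
      · intro x y h hx; simpa [← h s (by simp)] using hx
      · intro x y h hx; simpa [← h t (by simp)] using hx
    · intro x y h hx e he
      rw [← hx e he]
      have : ∀ a ∈ e, x a = y a := by
        intro a ha
        refine h a ?_
        simp only [Finset.mem_compl, Finset.mem_insert, Finset.mem_singleton, not_or]
        constructor <;> rintro rfl
        · exact (hE e he).1 ha
        · exact (hE e he).2 ha
      exact forall₂_congr fun a ha => by rw [this a ha]
    · intro x y h hx a ha
      rw [← h a (by simpa using ha)]
      exact hx a ha

/-- The retention in edge percolation. -/
lemma independentRetention_edge (p : H → unitInterval) :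
    IndependentRetention
      (Measure.pi fun e : Sym2 H => bernoulliMeasure true false (e.map p).mul)
      (fun e ω => ω e = true) (fun s => (p s : ℝ)) where
  real_inter E s t hst hE ρ := by
    classical
    rw [pi_real_inter_of_disjoint _ (S := {s(s, t)}ᶜ) (T := {s(s, t)}) disjoint_compl_left]
    · congr 1
      have := (measurePreserving_eval
        (fun e : Sym2 H => bernoulliMeasure true false (e.map p).mul) s(s, t))
      have h2 := this.measureReal_preimage (s := {true}) (MeasurableSet.nullMeasurableSet
        MeasurableSet.of_discrete)
      have h3 : (Function.eval s(s, t) ⁻¹' ({true} : Set Bool) : Set (Sym2 H → Bool)) = {ω : Sym2 H → Bool | ω s(s, t) = true} := by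
        ext; simp
      rw [h3] at h2
      rw [h2, bernoulliMeasure_real_apply _ MeasurableSet.of_discrete]
      simp
    · intro x y h hx e he
      rw [← hx e he, h e ?_]
      simp only [Finset.mem_compl, Finset.mem_singleton]
      rintro rfl
      exact (hE _ he).1 (by simp)
    · intro x y h hx
      simpa [← h s(s, t) (by simp)] using hx

-- Identify `H` with `Fin k × Bool` and flip the second coordinate.
omit [DecidableEq H] in
lemma pairing_nonempty (h : Even (Fintype.card H)) : Nonempty (Pairing H) := by
  obtain ⟨k, hk⟩ := h
  have e : H ≃ Fin k × Bool := Fintype.equivOfCardEq (by simp [hk, mul_two])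
  refine ⟨⟨e.symm.permCongr (Equiv.prodCongr (Equiv.refl (Fin k)) Equiv.boolNot), fun s => ?_⟩⟩
  simp only [Equiv.permCongr_apply, Equiv.symm_symm]
  constructor
  · intro h
    have := congrArg e h
    simp [Prod.ext_iff] at this
  · simp [Prod.map]

end UniformPairing

instance {V : Type} [Finite V] : DiscreteMeasurableSpace (SimpleGraph V) := by
  refine ⟨fun S => ⟨SimpleGraph.Adj '' S, (Set.toFinite _).measurableSet, ?_⟩⟩
  exact Set.preimage_image_eq _ fun G H h => SimpleGraph.ext h

/-! ### Distances for a fixed degree sequence -/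

section FixedDegrees

variable {n : ℕ}

/-- The graph law `Q` arises from the uniform pairing of the half-edges by retaining every edge
`{s, t}` with probability `p (d s.1) * p (d t.1)`, independently for disjoint edges. -/
def IsPercolationLaw (p : ℕ → unitInterval) (d : Fin n → ℕ) (Q : Measure (SimpleGraph (Fin n))) :
    Prop :=
  ∃ (Ω : Type) (_ : MeasurableSpace Ω) (_ : DiscreteMeasurableSpace Ω) (_ : Finite Ω)
    (π : Measure Ω) (_ : IsProbabilityMeasure π) (kept : Sym2 (HalfEdge d) → Ω → Prop),
    IndependentRetention π kept (fun s => (p (d s.1) : ℝ)) ∧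
      Q = ((uniformPairing (HalfEdge d)).prod π).map
        fun ω => pairedGraph ω.1 fun e => kept e ω.2

lemma isPercolationLaw_halfEdgePercolation (p : ℕ → unitInterval) (d : Fin n → ℕ) :
    IsPercolationLaw p d (halfEdgePercolation p d) :=
  ⟨_, _, inferInstance, inferInstance, _, inferInstance, _,
    independentRetention_halfEdge fun s : HalfEdge d => p (d s.1), rfl⟩

lemma isPercolationLaw_edgePercolation (p : ℕ → unitInterval) (d : Fin n → ℕ) :
    IsPercolationLaw p d (edgePercolation p d) :=
  ⟨_, _, inferInstance, inferInstance, _, inferInstance, _,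
    independentRetention_edge fun s : HalfEdge d => p (d s.1), rfl⟩

instance {H : Type} : IsZeroOrProbabilityMeasure (uniformPairing H) := by
  unfold uniformPairing uniformOn; infer_instance

instance {H Ω : Type} [MeasurableSpace Ω] (π : Measure Ω) [IsProbabilityMeasure π] :
    IsZeroOrProbabilityMeasure ((uniformPairing H).prod π) := by
  rcases eq_zero_or_isProbabilityMeasure (uniformPairing H) with h | h
  · rw [h, Measure.zero_prod]; infer_instance
  · infer_instance

/-- For an odd total degree there is no pairing and `uniformPairing` is the zero measure, so a
probability measure cannot be claimed for every `d`. -/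
lemma IsPercolationLaw.isZeroOrProbabilityMeasure {p : ℕ → unitInterval} {d : Fin n → ℕ}
    {Q : Measure (SimpleGraph (Fin n))} (hQ : IsPercolationLaw p d Q) :
    IsZeroOrProbabilityMeasure Q := by
  obtain ⟨Ω, _, _, _, π, _, kept, -, rfl⟩ := hQ
  rcases eq_zero_or_isProbabilityMeasure ((uniformPairing (HalfEdge d)).prod π) with h | h
  · rw [h, Measure.map_zero]; infer_instance
  · have := Measure.isProbabilityMeasure_map (μ := (uniformPairing (HalfEdge d)).prod π)
      (f := fun ω => pairedGraph ω.1 fun e => kept e ω.2) Measurable.of_discrete.aemeasurable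
    infer_instance

lemma IsPercolationLaw.isProbabilityMeasure {p : ℕ → unitInterval} {d : Fin n → ℕ}
    {Q : Measure (SimpleGraph (Fin n))} (hQ : IsPercolationLaw p d Q) (hd : Even (∑ i, d i)) :
    IsProbabilityMeasure Q := by
  obtain ⟨Ω, _, _, _, π, _, kept, -, rfl⟩ := hQ
  have : Nonempty (Pairing (HalfEdge d)) := pairing_nonempty (by simpa using hd)
  have : IsProbabilityMeasure (uniformPairing (HalfEdge d)) := by
    unfold uniformPairing; infer_instance
  exact Measure.isProbabilityMeasure_map Measurable.of_discrete.aemeasurable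

lemma edist_le_one_of_retained {d : Fin n → ℕ} (σ : Pairing (HalfEdge d))
    (retained : Sym2 (HalfEdge d) → Prop) (s : HalfEdge d) (hs : retained s(s, σ.1 s)) :
    (pairedGraph σ retained).edist s.1 (σ.1 s).1 ≤ 1 := by
  by_cases h : s.1 = (σ.1 s).1
  · rw [← h]; simp
  · have : (pairedGraph σ retained).Adj s.1 (σ.1 s).1 := ⟨h, s, rfl, rfl, hs⟩
    exact (SimpleGraph.edist_eq_one_iff_adj.2 this).le

lemma Climbs.exists_edist_le {d : Fin n → ℕ} {σ : Pairing (HalfEdge d)}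
    {retained : Sym2 (HalfEdge d) → Prop} {G : ℕ → Finset (Fin n)} (j : ℕ) :
    ∀ i, ∀ v ∈ G i, Climbs (fun s : HalfEdge d => s.1) G σ (fun s => retained s(s, σ.1 s)) j i v →
      ∃ x ∈ G (i + j), (pairedGraph σ retained).edist v x ≤ j := by
  induction j with
  | zero => exact fun i v hv _ => ⟨v, hv, by simp⟩
  | succ j ih =>
    rintro i v hv ⟨s, rfl, hs, hG, hc⟩
    obtain ⟨x, hx, hd⟩ := ih (i + 1) _ hG hc
    refine ⟨x, by rwa [add_assoc, add_comm 1] at hx, ?_⟩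
    refine SimpleGraph.edist_triangle.trans
      ((add_le_add (edist_le_one_of_retained σ retained s hs) hd).trans ?_)
    push_cast
    rw [add_comm]

lemma half_le_floor {z : ℝ} (hz : 1 ≤ z) : z / 2 ≤ ⌊z⌋₊ := by
  have h1 := Nat.lt_floor_add_one z
  have h2 : (1 : ℝ) ≤ ⌊z⌋₊ := by exact_mod_cast (Nat.one_le_floor_iff z).2 hz
  linarith

/-- With layers `G i` of vertices of degree at least `y i` and percolation probability at least
`P i`, a vertex of layer `0` is within distance `m` of layer `m`. -/
theorem IsPercolationLaw.real_not_climb_le {p : ℕ → unitInterval} {d : Fin n → ℕ}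
    {Q : Measure (SimpleGraph (Fin n))} (hQ : IsPercolationLaw p d Q) (m : ℕ) (y P : ℕ → ℝ)
    (G : ℕ → Finset (Fin n)) (hy : ∀ i ≤ m, ∀ v ∈ G i, y i ≤ d v)
    (hP : ∀ i ≤ m, ∀ v ∈ G i, P i ≤ p (d v)) (hP0 : ∀ i, 0 ≤ P i) (hP1 : ∀ i, P i ≤ 1)
    (hy0 : 8 ≤ y 0) (hyy : ∀ i < m, 2 * y i ≤ y (i + 1)) (hG : ∀ i < m, (G (i + 1)).Nonempty)
    {u : Fin n} (hu : u ∈ G 0) :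
    Q.real {g | ∀ v ∈ G m, ¬ g.edist u v ≤ m} ≤ ∑ i ∈ Finset.range m,
      Real.exp (-((G (i + 1)).card * y (i + 1) * y i * (P i * P (i + 1)) /
        (32 * ∑ v, (d v : ℝ)))) := by
  obtain ⟨Ω, _, _, _, π, _, kept, hret, rfl⟩ := hQ
  have hE := hret.explorable fun s => (p (d s.1)).2.1
  set L : ℝ := ∑ v, (d v : ℝ) with hL
  have hcardH : (Fintype.card (HalfEdge d) : ℝ) = L := by simp [hL]
  have hy8 : ∀ i ≤ m, 8 ≤ y i := by
    intro i
    induction i with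
    | zero => exact fun _ => hy0
    | succ i ih => intro hi; have := ih (by omega); have := hyy i hi; linarith
  -- `y i / 8` trials reveal at most `y i / 4` half-edges. As the `y i` at least double, all the
  -- trials up to layer `i` reveal at most `y i / 2`, so a vertex of layer `i` still has fresh
  -- half-edges.
  set t : ℕ → ℕ := fun i => ⌊y i / 8⌋₊ with ht
  set r : ℕ → ℕ := fun i => ∑ l ∈ Finset.range i, 2 * t l with hr
  have ht_le : ∀ i ≤ m, (t i : ℝ) ≤ y i / 8 := fun i hi =>
    Nat.floor_le (by have := hy8 i hi; linarith)
  have hr_le : ∀ i ≤ m, (r (i + 1) : ℝ) ≤ y i / 2 := by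
    intro i
    induction i with
    | zero =>
      intro h
      have := ht_le 0 h
      simp only [hr, zero_add, Finset.sum_range_one]
      push_cast; linarith
    | succ i ih =>
      intro h
      have h1 := ih (by omega)
      have h2 := ht_le (i + 1) h
      have h3 := hyy i h
      have : r (i + 1 + 1) = r (i + 1) + 2 * t (i + 1) := Finset.sum_range_succ _ _
      rw [this]; push_cast; linarith
  set T : ℕ → Finset (HalfEdge d) := fun i => {s | s.1 ∈ G i} with hT
  have hfib : ∀ v : Fin n, ({s | s.1 = v} : Finset (HalfEdge d)).card = d v := by
    intro v
    have : ({s | s.1 = v} : Finset (HalfEdge d)) = (Finset.univ : Finset (Fin (d v))).map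
        (Function.Embedding.sigmaMk v) := by
      ext ⟨a, b⟩
      simp only [Finset.mem_filter, Finset.mem_univ, true_and, Finset.mem_map,
        Function.Embedding.sigmaMk_apply]
      constructor
      · rintro rfl; exact ⟨b, rfl⟩
      · rintro ⟨c, h⟩; exact (congrArg Sigma.fst h).symm
    rw [this]; simp
  have hTcard : ∀ i ≤ m, (G i).card * y i ≤ (T i).card := by
    intro i hi
    have : (T i).card = ∑ v ∈ G i, d v := by
      rw [Finset.card_eq_sum_card_fiberwise (f := fun s : HalfEdge d => s.1) (t := G i)
        (fun s hs => by simpa [hT] using hs)]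
      refine Finset.sum_congr rfl fun v hv => ?_
      rw [← hfib v]
      congr 1
      ext s
      simp only [hT, Finset.mem_filter, Finset.mem_univ, true_and, and_iff_right_iff_imp]
      rintro rfl; exact hv
    rw [this]
    push_cast
    rw [← nsmul_eq_mul]
    exact Finset.card_nsmul_le_sum _ _ _ fun v hv => hy i hi v hv
  -- The 2 pays for the half-edges of the target already revealed, at most half of them. With `t i ≥
  -- y i / 16` this produces the 32 of the statement.
  set q : ℕ → ℝ := fun i => (T (i + 1)).card * (P i * P (i + 1)) / (2 * L) with hq
  have hTpos : ∀ i < m, y (i + 1) ≤ (T (i + 1)).card := by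
    intro i hi
    refine le_trans ?_ (hTcard (i + 1) hi)
    have h1 : (1 : ℝ) ≤ (G (i + 1)).card := by exact_mod_cast (hG i hi).card_pos
    have := hy8 (i + 1) hi
    nlinarith
  have hTL : ∀ i, ((T i).card : ℝ) ≤ L := by
    intro i; rw [← hcardH]; exact_mod_cast Finset.card_le_univ _
  have hLpos : ∀ i < m, 0 < L := by
    intro i hi
    have := hTpos i hi; have := hTL (i + 1); have := hy8 (i + 1) hi; linarith
  have hPP : ∀ i, P i * P (i + 1) ≤ 1 := fun i => mul_le_one₀ (hP1 _) (hP0 _) (hP1 _)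
  have hmain : ∀ x₀, _ := fun x₀ => measureReal_not_climbs_le hE (fun s : HalfEdge d => s.1) G m r t q
    (fun i _ => (Finset.sum_range_succ _ _).ge) ?_ ?_ ?_ m 0 (by simp) u hu ∅ x₀
    (by intro s hs; simp at hs) (by simp)
  · rw [map_measureReal_apply Measurable.of_discrete MeasurableSet.of_discrete]
    rcases isEmpty_or_nonempty (Pairing (HalfEdge d) × Ω) with hem | ⟨⟨x₀⟩⟩
    · rw [Set.eq_empty_of_isEmpty (_ ⁻¹' _)]
      simpa using Finset.sum_nonneg fun i _ => (Real.exp_pos _).le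
    · have h1 := hmain x₀
      -- The exploration starts with nothing revealed.
      have huniv : cylinder (fun x : Pairing (HalfEdge d) × Ω => x.1)
        (fun x s => kept s(s, x.1.1 s) x.2) ∅ x₀ = Set.univ := by
        ext; simp [cylinder]
      rw [huniv, Set.inter_univ] at h1
      have h2 : ((uniformPairing (HalfEdge d)).prod π).real Set.univ ≤ 1 := measureReal_le_one
      refine (measureReal_mono ?_).trans (h1.trans ?_)
      · intro x hx hc
        obtain ⟨v, hv, hd⟩ := Climbs.exists_edist_le (retained := fun e => kept e x.2) m 0 u hu hc
        exact hx v (by simpa using hv) hd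
      · have hnn : ∀ i ∈ Finset.range m, 0 ≤ (1 - q (0 + i)) ^ t (0 + i) ∧
            (1 - q (0 + i)) ^ t (0 + i) ≤ Real.exp (-((G (i + 1)).card * y (i + 1) * y i *
              (P i * P (i + 1)) / (32 * L))) := by
          intro i hi
          have him := Finset.mem_range.1 hi
          rw [zero_add]
          have hL0 := hLpos i him
          have hq1 : q i ≤ 1 := by
            rw [hq, div_le_one (by positivity)]
            have := hTL (i + 1)
            have := hPP i
            have := mul_nonneg (hP0 i) (hP0 (i + 1))
            nlinarith
          refine ⟨pow_nonneg (by linarith) _, ?_⟩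
          have hexp : 1 - q i ≤ Real.exp (- q i) := by
            have := Real.add_one_le_exp (- q i); linarith
          refine (pow_le_pow_left₀ (by linarith) hexp _).trans ?_
          rw [← Real.exp_nat_mul, Real.exp_le_exp, mul_neg, neg_le_neg_iff]
          have h8 := hy8 i him.le
          have hti : y i / 16 ≤ t i := by
            have := half_le_floor (z := y i / 8) (by linarith)
            simp only [ht]; linarith
          have hpp := mul_nonneg (hP0 i) (hP0 (i + 1))
          have hqi : (G (i + 1)).card * y (i + 1) * (P i * P (i + 1)) / (2 * L) ≤ q i := by
            simp only [hq]
            gcongr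
            exact hTcard (i + 1) him
          have h81 := hy8 (i + 1) him
          calc _ = y i / 16 * ((G (i + 1)).card * y (i + 1) * (P i * P (i + 1)) / (2 * L)) := by
                field_simp; ring
            _ ≤ t i * q i := by gcongr
        calc _ ≤ (∑ l ∈ Finset.range m, (1 - q (0 + l)) ^ t (0 + l)) * 1 :=
              mul_le_mul_of_nonneg_left h2 (Finset.sum_nonneg fun i hi => (hnn i hi).1)
          _ ≤ _ := by
            rw [mul_one]
            exact Finset.sum_le_sum fun i hi => (hnn i hi).2
  · intro i hi
    have hL0 := hLpos i hi
    rw [hq, div_le_one (by positivity)]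
    have := hTL (i + 1)
    have := hPP i
    have := mul_nonneg (hP0 i) (hP0 (i + 1))
    nlinarith
  · intro i hi v hv
    rw [hfib]
    have h1 := hr_le i hi.le
    have h2 := hy i hi.le v hv
    have h3 := hy8 i hi.le
    have : (r (i + 1) : ℝ) ≤ d v := by linarith
    exact_mod_cast this
  · intro i hi v hv R hR s hs
    have hL0 := hLpos i hi
    have hpp := mul_nonneg (hP0 i) (hP0 (i + 1))
    have hcard : ((T (i + 1)).card : ℝ) / 2 ≤ (T (i + 1) \ insert s R).card := by
      have h1 := Finset.le_card_sdiff (insert s R) (T (i + 1))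
      have h2 := Finset.card_insert_le s R
      have h3 : (T (i + 1)).card ≤ (T (i + 1) \ insert s R).card + r (i + 1) := by omega
      have h4 : ((T (i + 1)).card : ℝ) ≤ (T (i + 1) \ insert s R).card + r (i + 1) := by
        exact_mod_cast h3
      have h5 := hr_le i hi.le
      have h6 := hTpos i hi
      have h7 := hyy i hi
      have h8 := hy8 i hi.le
      linarith
    calc q i = (T (i + 1)).card / 2 * (P i * P (i + 1) / L) := by
          simp only [hq]; field_simp
      _ ≤ (T (i + 1) \ insert s R).card * (P i * P (i + 1) / L) := by gcongr
      _ ≤ _ := by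
        rw [← nsmul_eq_mul]
        refine Finset.card_nsmul_le_sum _ _ _ fun a ha => ?_
        rw [hcardH]
        have ha' : a.1 ∈ G (i + 1) := by
          have := (Finset.mem_sdiff.1 ha).1
          simpa [hT] using this
        have h1 := hP i hi.le v hv
        have h2 := hP (i + 1) hi a.1 ha'
        rw [hs]
        have := hP0 i
        have := hP0 (i + 1)
        have := (p (d v)).2.1
        gcongr

/-- Two vertices of degree at least `y` are directly linked. -/
lemma IsPercolationLaw.real_not_linked_le {p : ℕ → unitInterval} {d : Fin n → ℕ}
    {Q : Measure (SimpleGraph (Fin n))} (hQ : IsPercolationLaw p d Q) {y P : ℝ} {u v : Fin n}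
    (hy : 16 ≤ y) (hP0 : 0 ≤ P) (hP1 : P ≤ 1) (hu : y ≤ d u) (hv : y ≤ d v) (hPu : P ≤ p (d u))
    (hPv : P ≤ p (d v)) :
    Q.real {g | ¬ g.edist u v ≤ 1} ≤ Real.exp (-(y ^ 2 * P ^ 2 / (64 * ∑ v, (d v : ℝ)))) := by
  -- A climb of one step from `{u}` to `{v}`; the degree bound at `u` is weakened to `y / 2` to meet
  -- the doubling condition.
  have := hQ.real_not_climb_le 1 (fun i => if i = 0 then y / 2 else y) (fun _ => P)
    (fun i => if i = 0 then {u} else {v}) ?_ ?_ (fun _ => hP0) (fun _ => hP1) (by simp; linarith)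
    ?_ (by simp) (u := u) (by simp)
  · simp only [Finset.range_one, Finset.sum_singleton, zero_add, one_ne_zero, if_false, if_true,
      Finset.mem_singleton, forall_eq, Finset.card_singleton, Nat.cast_one] at this
    refine this.trans (le_of_eq ?_)
    congr 2
    ring
  · intro i hi w hw
    interval_cases i <;> simp at hw <;> subst hw <;> simp <;> linarith
  · intro i hi w hw
    interval_cases i <;> simp at hw <;> subst hw <;> assumption
  · intro i hi
    obtain rfl : i = 0 := by omega
    simp; linarith

/-- Two vertices of layer `0` are within distance `2 m + 1`. -/
theorem IsPercolationLaw.real_far_le {p : ℕ → unitInterval} {d : Fin n → ℕ}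
    {Q : Measure (SimpleGraph (Fin n))} (hQ : IsPercolationLaw p d Q) (m : ℕ) (y P : ℕ → ℝ)
    (G : ℕ → Finset (Fin n)) (hy : ∀ i ≤ m, ∀ v ∈ G i, y i ≤ d v)
    (hP : ∀ i ≤ m, ∀ v ∈ G i, P i ≤ p (d v)) (hP0 : ∀ i, 0 ≤ P i) (hP1 : ∀ i, P i ≤ 1)
    (hy0 : 16 ≤ y 0) (hyy : ∀ i < m, 2 * y i ≤ y (i + 1)) (hG : ∀ i < m, (G (i + 1)).Nonempty)
    {u v : Fin n} (hu : u ∈ G 0) (hv : v ∈ G 0) :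
    Q.real {g | ¬ g.edist u v ≤ (2 * m + 1 : ℕ)} ≤ 2 * (∑ i ∈ Finset.range m,
      Real.exp (-((G (i + 1)).card * y (i + 1) * y i * (P i * P (i + 1)) /
        (32 * ∑ v, (d v : ℝ))))) +
      (G m).card ^ 2 * Real.exp (-(y m ^ 2 * P m ^ 2 / (64 * ∑ v, (d v : ℝ)))) := by
  have := hQ.isZeroOrProbabilityMeasure
  have hc := fun {u} hu => hQ.real_not_climb_le m y P G hy hP hP0 hP1 (by linarith) hyy hG (u := u) hu
  have hym : 16 ≤ y m := by
    have : ∀ i ≤ m, 16 ≤ y i := by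
      intro i
      induction i with
      | zero => exact fun _ => hy0
      | succ i ih => intro hi; have := ih (by omega); have := hyy i hi; linarith
    exact this m le_rfl
  have hl : Q.real (⋃ e ∈ G m ×ˢ G m, {g | ¬ g.edist e.1 e.2 ≤ 1}) ≤
      (G m).card ^ 2 * Real.exp (-(y m ^ 2 * P m ^ 2 / (64 * ∑ v, (d v : ℝ)))) := by
    refine (measureReal_biUnion_finset_le _ _).trans ?_
    refine (Finset.sum_le_card_nsmul _ _
      (Real.exp (-(y m ^ 2 * P m ^ 2 / (64 * ∑ v, (d v : ℝ))))) fun e he => ?_).trans ?_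
    · obtain ⟨h1, h2⟩ := Finset.mem_product.1 he
      exact hQ.real_not_linked_le hym (hP0 m) (hP1 m) (hy m le_rfl _ h1) (hy m le_rfl _ h2)
        (hP m le_rfl _ h1) (hP m le_rfl _ h2)
    · rw [Finset.card_product, nsmul_eq_mul, pow_two (_ : ℝ)]; push_cast; rw [pow_two ((G m).card : ℝ)]
  have hsub : {g : SimpleGraph (Fin n) | ¬ g.edist u v ≤ (2 * m + 1 : ℕ)} ⊆
      ({g | ∀ x ∈ G m, ¬ g.edist u x ≤ m} ∪ {g | ∀ x ∈ G m, ¬ g.edist v x ≤ m}) ∪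
        ⋃ e ∈ G m ×ˢ G m, {g | ¬ g.edist e.1 e.2 ≤ 1} := by
    intro g hg
    by_contra hcon
    simp only [Set.mem_union, Set.mem_ofPred_eq, Set.mem_iUnion, not_or, not_forall, not_not,
      not_exists, exists_prop, Prod.forall, Finset.mem_product] at hcon
    obtain ⟨⟨⟨x, hx, hux⟩, ⟨x', hx', hvx⟩⟩, hlink⟩ := hcon
    apply hg
    calc g.edist u v ≤ g.edist u x + g.edist x x' + g.edist x' v :=
          SimpleGraph.edist_triangle.trans (add_le_add_left SimpleGraph.edist_triangle _)
      _ ≤ m + 1 + m := by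
        rw [SimpleGraph.edist_comm (u := x')]
        exact add_le_add (add_le_add hux (not_not.1 fun h => hlink x x' ⟨⟨hx, hx'⟩, h⟩)) hvx
      _ = (2 * m + 1 : ℕ) := by push_cast; ring
  refine (measureReal_mono hsub).trans ((measureReal_union_le _ _).trans
    (add_le_add ((measureReal_union_le _ _).trans ?_) hl))
  rw [two_mul]
  exact add_le_add (hc hu) (hc hv)

end FixedDegrees

/-! ### Growth estimates and the sequence of layers -/

section Asymptotics

open Filter Topology

/-- Sublinear powers are eventually dominated by linear functions. -/
lemma eventually_rpow_add_le {g : ℝ} (hg : g < 1) (b M : ℝ) {a : ℝ} (ha : 0 < a) :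
    ∀ᶠ x : ℝ in atTop, b * x ^ g + M ≤ a * x := by
  have h1 : (fun x : ℝ => b * x ^ g) =o[atTop] fun x : ℝ => x := by
    refine Asymptotics.IsLittleO.const_mul_left ?_ _
    refine Asymptotics.isLittleO_of_tendsto' ?_ ?_
    · filter_upwards [eventually_gt_atTop 0] with x hx h using absurd h hx.ne'
    · refine (tendsto_rpow_neg_atTop (sub_pos.2 hg)).congr' ?_
      filter_upwards [eventually_gt_atTop 0] with x hx
      rw [neg_sub, Real.rpow_sub hx, Real.rpow_one]
  have h2 : (fun _ : ℝ => M) =o[atTop] fun x : ℝ => x :=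
    Asymptotics.isLittleO_const_id_atTop M
  filter_upwards [(h1.add h2).def ha, eventually_ge_atTop 0] with x hx hx0
  rw [Real.norm_eq_abs, Real.norm_eq_abs, abs_of_nonneg hx0] at hx
  exact (le_abs_self _).trans hx

lemma tendsto_exp_rpow_sub {g : ℝ} (hg : g < 1) (b : ℝ) {a : ℝ} (ha : 0 < a) :
    Tendsto (fun x : ℝ => Real.exp (b * x ^ g - a * x)) atTop (𝓝 0) := by
  refine Real.tendsto_exp_atBot.comp ?_
  have h : Tendsto (fun x : ℝ => -(a / 2 * x)) atTop atBot :=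
    tendsto_neg_atTop_atBot.comp (tendsto_id.const_mul_atTop (by positivity))
  refine tendsto_atBot_mono' _ ?_ h
  filter_upwards [eventually_rpow_add_le hg b 0 (half_pos ha)] with x hx
  linarith

lemma eventually_mul_exp_rpow_sub_le {g : ℝ} (hg : g < 1) (M b : ℝ) {a ε : ℝ} (ha : 0 < a)
    (hε : 0 < ε) : ∀ᶠ x : ℝ in atTop, M * x * Real.exp (b * x ^ g - a * x) ≤ ε := by
  have h1 := tendsto_exp_rpow_sub hg b (half_pos ha)
  have h2 : Tendsto (fun x : ℝ => x * Real.exp (-(a / 2) * x)) atTop (𝓝 0) := by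
    simpa using tendsto_rpow_mul_exp_neg_mul_atTop_nhds_zero 1 (a / 2) (half_pos ha)
  have h3 := (h2.mul h1).const_mul M
  simp only [mul_zero] at h3
  filter_upwards [h3.eventually (ge_mem_nhds hε)] with x hx
  refine le_trans (le_of_eq ?_) hx
  rw [mul_assoc, mul_assoc, ← Real.exp_add]
  ring_nf

lemma eventually_exp_sub_exp_le (η M : ℝ) {a ε : ℝ} (hη : 0 < η) (ha : 0 < a) (hε : 0 < ε) :
    ∀ᶠ x : ℝ in atTop, Real.exp (M * x - η * Real.exp (a * x)) ≤ ε := by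
  have h1 : (fun x : ℝ => (M + 1) * x) =o[atTop] fun x : ℝ => Real.exp (a * x) := by
    refine Asymptotics.IsLittleO.const_mul_left ?_ _
    simpa using isLittleO_rpow_exp_pos_mul_atTop 1 ha
  have h2 := Real.tendsto_exp_neg_atTop_nhds_zero
  filter_upwards [h1.def hη, h2.eventually (ge_mem_nhds hε)] with x hx hx2
  refine le_trans (Real.exp_le_exp.2 ?_) hx2
  rw [Real.norm_eq_abs, Real.norm_eq_abs, abs_of_pos (Real.exp_pos _)] at hx
  have := (le_abs_self _).trans hx
  linarith

/-- The logarithms `x i` of the degrees of the layers, from `x 0` comparable to `X` to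
`x m` close to `β * N`, where each step multiplies by nearly `1 / θ`. -/
lemma exists_layers {θ g B β : ℝ} (hθ : 0 < θ) (hθ1 : θ < 1) (hg : 0 < g) (hg1 : g < 1)
    (hB : 0 ≤ B) (hβ : 1 / 2 < β) (hβ1 : β ≤ 1) :
    ∃ D : ℝ, 0 ≤ D ∧ ∀ S : ℝ, 0 < S → ∃ X₀ : ℝ, ∀ X ≥ X₀, ∀ N ≥ X, ∃ (m : ℕ) (x : ℕ → ℝ),
      (m : ℝ) < Real.log N / |Real.log θ| ∧ x 0 ≤ X ∧ θ * X / 2 ≤ x 0 ∧ (∀ i, S ≤ x i) ∧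
      (∀ i, x i + Real.log 2 ≤ x (i + 1)) ∧ (∀ i, θ * x (i + 1) + B * x (i + 1) ^ g ≤ x i) ∧
      β * N ≤ x m ∧ x m ≤ β * N + D * N ^ g ∧
      ∑ i ∈ Finset.range m, Real.exp (-(x (i + 1) ^ g)) ≤ 1 / S := by
  have hθg : θ < θ ^ g := by
    simpa using Real.rpow_lt_rpow_of_exponent_gt hθ hθ1 hg1
  -- The layers are `x i = σ i + D σ i ^ g` with `σ` geometric of ratio `1 / θ`. In the step
  -- inequality the linear parts cancel. As `x i ≤ 2 σ i`, it remains that `D θ + 2^g B ≤ D θ^g`,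
  -- which this `D` turns into an equality; `θ < θ^g` makes it nonnegative.
  set D : ℝ := 2 ^ g * B / (θ ^ g - θ) with hD
  have hDpos : 0 ≤ D := div_nonneg (by positivity) (by linarith)
  refine ⟨D, hDpos, fun S hS => ?_⟩
  have hlogθ : Real.log θ < 0 := Real.log_neg hθ hθ1
  have hexp : ∀ᶠ x : ℝ in atTop, Real.exp (-(x ^ g)) ≤ 1 / x := by
    have := (isLittleO_log_rpow_atTop hg).def one_pos
    filter_upwards [this, eventually_gt_atTop 1] with x hx hx1
    rw [Real.norm_eq_abs, Real.norm_eq_abs, one_mul, abs_of_nonneg (Real.log_nonneg hx1.le),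
      abs_of_nonneg (by positivity)] at hx
    rw [Real.exp_neg, one_div]
    exact inv_anti₀ (by linarith) ((Real.log_le_iff_le_exp (by linarith)).1 hx)
  obtain ⟨S₁, hS₁⟩ := eventually_atTop.1 ((eventually_rpow_add_le hg1 D 0 one_pos).and
    (hexp.and ((eventually_ge_atTop (max S 1)).and
      ((eventually_ge_atTop (Real.log 2 / (θ⁻¹ - 1))).and
        (eventually_ge_atTop (S / (1 - θ)))))))
  obtain ⟨X₁, hX₁⟩ := eventually_atTop.1 (Real.tendsto_log_atTop.eventually_gt_atTop
    (Real.log (2 * β) - Real.log θ))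
  refine ⟨max (max 2 X₁) (2 * S₁ / θ), fun X hX N hN => ?_⟩
  have hX2 : 2 ≤ X := le_trans (le_trans (le_max_left _ _) (le_max_left _ _)) hX
  have hXX₁ : X₁ ≤ X := le_trans (le_trans (le_max_right _ _) (le_max_left _ _)) hX
  have hXS : S₁ ≤ θ * X / 2 := by
    have := le_trans (le_max_right _ _) hX
    rw [div_le_iff₀ hθ] at this
    linarith
  have hN0 : 0 < N := by linarith
  have hX0 : 0 < X := by linarith
  have hratio : 1 ≤ 2 * β * N / X := by
    rw [le_div_iff₀ hX0]; nlinarith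
  -- The number of steps is chosen so that going down from `β N` by factors `θ` ends at `s` between
  -- `θ X / 2` and `X / 2`; the factor 2 leaves room for `x 0 ≤ 2 s`. For large `X`, the `log X`
  -- gained here pays for rounding up and yields the strict bound on `m`.
  set z : ℝ := Real.log (2 * β * N / X) / (-Real.log θ) with hz
  have hz0 : 0 ≤ z := div_nonneg (Real.log_nonneg hratio) (by linarith)
  set m : ℕ := ⌈z⌉₊ with hm
  have hzm : z ≤ m := Nat.le_ceil z
  have hmz : (m : ℝ) < z + 1 := Nat.ceil_lt_add_one hz0
  have hzlog : z * (-Real.log θ) = Real.log (2 * β * N / X) :=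
    div_mul_cancel₀ _ (by linarith)
  set s : ℝ := β * N * θ ^ m with hs
  have hpow : θ ^ m = Real.exp (m * Real.log θ) := by
    rw [← Real.rpow_natCast, Real.rpow_def_of_pos hθ, mul_comm]
  have hinv : Real.exp (-(z * (-Real.log θ))) = X / (2 * β * N) := by
    rw [hzlog, Real.exp_neg, Real.exp_log (by linarith), inv_div]
  have hs_le : s ≤ X / 2 := by
    have h1 : θ ^ m ≤ X / (2 * β * N) := by
      rw [← hinv, hpow, Real.exp_le_exp]; nlinarith
    calc s ≤ β * N * (X / (2 * β * N)) := by
          refine mul_le_mul_of_nonneg_left h1 (by positivity)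
      _ = X / 2 := by field_simp
  have hs_ge : θ * X / 2 ≤ s := by
    have h1 : θ * (X / (2 * β * N)) ≤ θ ^ m := by
      rw [← hinv, hpow]
      nth_rewrite 1 [← Real.exp_log hθ]
      rw [← Real.exp_add, Real.exp_le_exp]; nlinarith
    calc θ * X / 2 = β * N * (θ * (X / (2 * β * N))) := by field_simp
      _ ≤ s := mul_le_mul_of_nonneg_left h1 (by positivity)
  have hsS : S₁ ≤ s := hXS.trans hs_ge
  have hs1 : 1 ≤ s := (le_max_right S 1).trans (hS₁ s hsS).2.2.1
  have hs0 : 0 < s := by linarith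
  set σ : ℕ → ℝ := fun i => s * (θ⁻¹) ^ i with hσ
  have hθinv : 1 < θ⁻¹ := (one_lt_inv₀ hθ).2 hθ1
  have hσge : ∀ i, s ≤ σ i := fun i => le_mul_of_one_le_right hs0.le (one_le_pow₀ hθinv.le)
  have hσ0 : ∀ i, 0 < σ i := fun i => hs0.trans_le (hσge i)
  have hσS := fun i => hS₁ (σ i) (hsS.trans (hσge i))
  have hσsucc : ∀ i, σ (i + 1) = θ⁻¹ * σ i := fun i => by simp only [hσ, pow_succ]; ring
  have hσsucc' : ∀ i, θ * σ (i + 1) = σ i := fun i => by rw [hσsucc]; field_simp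
  have hσm : σ m = β * N := by
    simp only [hσ, hs]
    rw [mul_assoc, ← mul_pow, mul_inv_cancel₀ hθ.ne', one_pow, mul_one]
  have hxge : ∀ i, σ i ≤ σ i + D * σ i ^ g := fun i =>
    le_add_of_nonneg_right (mul_nonneg hDpos (Real.rpow_nonneg (hσ0 i).le _))
  have hxle : ∀ i, σ i + D * σ i ^ g ≤ 2 * σ i := fun i => by
    have := (hσS i).1; linarith
  refine ⟨m, fun i => σ i + D * σ i ^ g, ?_, ?_, ?_, ?_, ?_, ?_, ?_, ?_, ?_⟩
  · rw [abs_of_neg hlogθ, lt_div_iff₀ (by linarith)]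
    have h1 := hX₁ X hXX₁
    have h2 : Real.log (2 * β * N / X) = Real.log (2 * β) + Real.log N - Real.log X := by
      rw [Real.log_div (by positivity) hX0.ne', Real.log_mul (by positivity) hN0.ne']
    nlinarith
  · have := hxle 0
    simp only [hσ, pow_zero, mul_one] at this ⊢
    linarith
  · have := hxge 0
    simp only [hσ, pow_zero, mul_one] at this ⊢
    linarith
  · intro i
    exact ((le_max_left S 1).trans (hσS i).2.2.1).trans (hxge i)
  · intro i
    have h1 : D * σ i ^ g ≤ D * σ (i + 1) ^ g := by
      refine mul_le_mul_of_nonneg_left (Real.rpow_le_rpow (hσ0 i).le ?_ hg.le) hDpos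
      rw [hσsucc]; exact le_mul_of_one_le_left (hσ0 i).le hθinv.le
    have h2 : Real.log 2 ≤ σ i * (θ⁻¹ - 1) := by
      rw [← div_le_iff₀ (by linarith)]
      exact (hσS i).2.2.2.1
    rw [mul_sub, mul_comm, ← hσsucc] at h2
    show σ i + D * σ i ^ g + Real.log 2 ≤ σ (i + 1) + D * σ (i + 1) ^ g
    linarith
  · intro i
    have h1 : (σ (i + 1) + D * σ (i + 1) ^ g) ^ g ≤ 2 ^ g * σ (i + 1) ^ g := by
      rw [← Real.mul_rpow (by norm_num) (hσ0 _).le]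
      exact Real.rpow_le_rpow ((hσ0 _).le.trans (hxge _)) (hxle _) hg.le
    have h2 : σ i ^ g = θ ^ g * σ (i + 1) ^ g := by
      rw [← hσsucc' i, Real.mul_rpow hθ.le (hσ0 _).le]
    have h3 : D * (θ ^ g - θ) = 2 ^ g * B := div_mul_cancel₀ _ (by linarith)
    have h4 := mul_le_mul_of_nonneg_left h1 hB
    have h5 := congrArg (· * σ (i + 1) ^ g) h3
    have h6 := hσsucc' i
    beta_reduce at h5
    show θ * (σ (i + 1) + D * σ (i + 1) ^ g) + B * (σ (i + 1) + D * σ (i + 1) ^ g) ^ g ≤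
      σ i + D * σ i ^ g
    rw [h2]
    linarith
  · rw [← hσm]; exact hxge m
  · show σ m + D * σ m ^ g ≤ _
    rw [hσm]
    have : (β * N) ^ g ≤ N ^ g := Real.rpow_le_rpow (by positivity)
      (mul_le_of_le_one_left hN0.le hβ1) hg.le
    linarith [mul_le_mul_of_nonneg_left this hDpos]
  -- Since `exp(-x^g) ≤ 1 / x` for large `x`, the sum is dominated by a geometric series with first
  -- term `1 / s`, whatever `m` is.
  · have hterm : ∀ i, Real.exp (-((σ (i + 1) + D * σ (i + 1) ^ g) ^ g)) ≤ (1 / s) * θ ^ i := by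
      intro i
      calc _ ≤ Real.exp (-(σ (i + 1) ^ g)) := by
            rw [Real.exp_le_exp, neg_le_neg_iff]
            exact Real.rpow_le_rpow (hσ0 _).le (hxge _) hg.le
        _ ≤ 1 / σ (i + 1) := (hσS (i + 1)).2.1
        _ ≤ 1 / σ i := by
          refine one_div_le_one_div_of_le (hσ0 i) ?_
          rw [hσsucc]; exact le_mul_of_one_le_left (hσ0 i).le hθinv.le
        _ = _ := by
          simp only [hσ]
          rw [one_div, mul_inv, inv_pow, inv_inv, one_div]
    calc _ ≤ ∑ i ∈ Finset.range m, (1 / s) * θ ^ i := Finset.sum_le_sum fun i _ => hterm i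
      _ = 1 / s * ∑ i ∈ Finset.range m, θ ^ i := (Finset.mul_sum ..).symm
      _ ≤ 1 / s * (1 - θ)⁻¹ := by
        refine mul_le_mul_of_nonneg_left ?_ (by positivity)
        rw [← tsum_geometric_of_lt_one hθ.le hθ1]
        exact (summable_geometric_of_lt_one hθ.le hθ1).sum_le_tsum _ fun i _ => by positivity
      _ ≤ 1 / S := by
        have h1 := (hS₁ s hsS).2.2.2.2
        rw [div_le_iff₀ (by linarith)] at h1
        rw [one_div, ← mul_inv, one_div]
        exact inv_anti₀ hS h1

end Asymptotics

/-! ### I.i.d. degrees, the parity correction, and tails -/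

section Degrees

variable {n : ℕ} (μ : Measure ℕ) [IsProbabilityMeasure μ]

lemma pi_real_eval_mem (u : Fin n) (U : Set ℕ) :
    (Measure.pi fun _ : Fin n => μ).real {d | d u ∈ U} = μ.real U :=
  (measurePreserving_eval (fun _ : Fin n => μ) u).measureReal_preimage
    MeasurableSet.of_discrete.nullMeasurableSet

lemma pi_real_eval_mem_eval_mem {u v : Fin n} (huv : u ≠ v) (U V : Set ℕ) :
    (Measure.pi fun _ : Fin n => μ).real {d | d u ∈ U ∧ d v ∈ V} = μ.real U * μ.real V := by
  have : {d : Fin n → ℕ | d u ∈ U ∧ d v ∈ V} = {d | d u ∈ U} ∩ {d | d v ∈ V} := rfl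
  rw [this, pi_real_inter_of_disjoint _ (S := {u}) (T := {v}) (by simpa using huv),
    pi_real_eval_mem, pi_real_eval_mem]
  · intro x y h hx; simpa [← h u (by simp)] using hx
  · intro x y h hx; simpa [← h v (by simp)] using hx

/-- Markov's inequality; it will control the total degree. -/
lemma pi_real_lt_sum_le (hint : Integrable (fun d : ℕ => (d : ℝ)) μ) (W : Finset (Fin n)) {M : ℝ}
    (hM : 0 < M) : (Measure.pi fun _ : Fin n => μ).real {d | M < ∑ w ∈ W, (d w : ℝ)} ≤
      W.card * (∫ d, (d : ℝ) ∂μ) / M := by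
  have hmp := fun w => measurePreserving_eval (fun _ : Fin n => μ) w
  have hw : ∀ w : Fin n, Integrable (fun d : Fin n → ℕ => (d w : ℝ)) (Measure.pi fun _ => μ) :=
    fun w => (hmp w).integrable_comp_of_integrable hint
  have hI : ∫ d, ∑ w ∈ W, (d w : ℝ) ∂(Measure.pi fun _ : Fin n => μ) =
      W.card * (∫ d, (d : ℝ) ∂μ) := by
    rw [integral_finsetSum _ fun w _ => hw w]
    rw [← nsmul_eq_mul, ← Finset.sum_const]
    refine Finset.sum_congr rfl fun w _ => ?_
    have := integral_map (μ := Measure.pi fun _ : Fin n => μ) (φ := Function.eval w)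
      (hmp w).measurable.aemeasurable (f := fun d : ℕ => (d : ℝ))
      (Measurable.of_discrete.aestronglyMeasurable)
    rw [(hmp w).map_eq] at this
    exact this.symm
  have := mul_meas_ge_le_integral_of_nonneg (μ := Measure.pi fun _ : Fin n => μ)
    (f := fun d : Fin n → ℕ => ∑ w ∈ W, (d w : ℝ))
    (Filter.Eventually.of_forall fun d => Finset.sum_nonneg fun w _ => Nat.cast_nonneg _)
    (integrable_finsetSum _ fun w _ => hw w) M
  rw [hI] at this
  rw [le_div_iff₀ hM, mul_comm]
  refine le_trans (mul_le_mul_of_nonneg_left (measureReal_mono ?_) hM.le) this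
  intro d hd
  exact (show M < ∑ w ∈ W, (d w : ℝ) from hd).le

-- Chebyshev's inequality: a sum of independent indicators has variance at most its mean `A`, and `A
-- / (A / 2)^2 = 4 / A`. It will guarantee that the layers are populated.
open Classical in
lemma pi_real_card_lt_le (W : Finset (Fin n)) (I : Set ℕ) (hW : W.Nonempty) (hI : 0 < μ.real I) :
    (Measure.pi fun _ : Fin n => μ).real
      {d | ((W.filter fun w => d w ∈ I).card : ℝ) < W.card * μ.real I / 2} ≤
        4 / (W.card * μ.real I) := by
  set ν := Measure.pi fun _ : Fin n => μ with hν
  have hmp := fun w => measurePreserving_eval (fun _ : Fin n => μ) w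
  set f : ℕ → ℝ := I.indicator 1 with hf
  set X : Fin n → (Fin n → ℕ) → ℝ := fun w d => f (d w) with hX
  have hfm : Measurable f := Measurable.of_discrete
  have hf01 : ∀ d, f d = 0 ∨ f d = 1 := fun d => by
    by_cases h : d ∈ I <;> simp [hf, h]
  have hLp : ∀ w, MemLp (X w) 2 ν := fun w =>
    MemLp.of_bound (hfm.comp (measurable_pi_apply w)).aestronglyMeasurable 1
      (Filter.Eventually.of_forall fun d => by
        rcases hf01 (d w) with h | h <;> simp [hX, h])
  have hEX : ∀ w, ∫ d, X w d ∂ν = μ.real I := by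
    intro w
    have := integral_map (μ := ν) (φ := Function.eval w)
      (hmp w).measurable.aemeasurable (f := f) hfm.aestronglyMeasurable
    rw [(hmp w).map_eq, hf, integral_indicator_one MeasurableSet.of_discrete] at this
    exact this.symm
  have hind : iIndepFun X ν :=
    (iIndepFun_pi (X := fun _ => f) fun i => hfm.aemeasurable)
  have hvar : Var[∑ w ∈ W, X w; ν] ≤ W.card * μ.real I := by
    rw [IndepFun.variance_sum (fun w _ => hLp w) (fun i _ j _ hij => hind.indepFun hij)]
    rw [← nsmul_eq_mul]
    refine Finset.sum_le_card_nsmul _ _ _ fun w _ => ?_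
    refine (variance_le_expectation_sq (hLp w).1).trans (le_of_eq ?_)
    rw [← hEX w]
    congr 1
    ext d
    rcases hf01 (d w) with h | h <;> simp [hX, h]
  have hES : ∫ d, (∑ w ∈ W, X w) d ∂ν = W.card * μ.real I := by
    simp only [Finset.sum_apply]
    rw [integral_finsetSum _ fun w _ => (hLp w).integrable (by norm_num)]
    simp [hEX]
  have hcard : (0 : ℝ) < W.card := by exact_mod_cast hW.card_pos
  set A := W.card * μ.real I with hA
  have hApos : 0 < A := mul_pos hcard hI
  have hcheb := meas_ge_le_variance_div_sq (μ := ν) (X := ∑ w ∈ W, X w)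
    (memLp_finsetSum' _ fun w _ => hLp w) (half_pos hApos)
  have hreal : ν.real {d | A / 2 ≤ |(∑ w ∈ W, X w) d - ∫ d, (∑ w ∈ W, X w) d ∂ν|} ≤
      Var[∑ w ∈ W, X w; ν] / (A / 2) ^ 2 := by
    rw [measureReal_def]
    exact ENNReal.toReal_le_of_le_ofReal (div_nonneg (variance_nonneg _ _) (by positivity)) hcheb
  refine (measureReal_mono ?_).trans (hreal.trans ?_)
  · intro d hd
    have h1 : ((W.filter fun w => d w ∈ I).card : ℝ) = (∑ w ∈ W, X w) d := by
      simp only [Finset.sum_apply, hX, hf, Set.indicator_apply, Pi.one_apply, Finset.sum_boole]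
    have hd' : ((W.filter fun w => d w ∈ I).card : ℝ) < A / 2 := hd
    show A / 2 ≤ |(∑ w ∈ W, X w) d - ∫ d, (∑ w ∈ W, X w) d ∂ν|
    rw [hES, ← h1, abs_of_nonpos (by linarith)]
    linarith
  · rw [div_le_div_iff₀ (by positivity) hApos]
    nlinarith

lemma evenDegrees_le (d : Fin n → ℕ) (i : Fin n) : evenDegrees d i ≤ d i + 1 := by
  unfold evenDegrees; split_ifs <;> omega

lemma le_evenDegrees (d : Fin n → ℕ) (i : Fin n) : d i ≤ evenDegrees d i := by
  unfold evenDegrees; split_ifs <;> omega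

lemma evenDegrees_of_ne (d : Fin n → ℕ) {i : Fin n} (hi : (i : ℕ) + 1 ≠ n) :
    evenDegrees d i = d i := by
  simp [evenDegrees, hi]

lemma sum_evenDegrees (d : Fin (n + 1) → ℕ) :
    ∑ i, evenDegrees d i = ∑ i, d i + if Odd (∑ i, d i) then 1 else 0 := by
  rw [Fin.sum_univ_castSucc, Fin.sum_univ_castSucc (f := d), add_assoc]
  congr 1
  · exact Finset.sum_congr rfl fun i _ => evenDegrees_of_ne d (by simpa using i.2.ne)
  · simp only [evenDegrees, Fin.val_last, and_true, Fin.sum_univ_castSucc]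
    split_ifs <;> rfl

lemma even_sum_evenDegrees (hn : 0 < n) (d : Fin n → ℕ) : Even (∑ i, evenDegrees d i) := by
  obtain ⟨n, rfl⟩ : ∃ k, n = k + 1 := ⟨n - 1, by omega⟩
  rw [sum_evenDegrees]
  split_ifs with h
  · exact h.add_one
  · simpa using h

lemma sum_evenDegrees_le (hn : 0 < n) (d : Fin n → ℕ) :
    ∑ i, evenDegrees d i ≤ ∑ i, d i + 1 := by
  obtain ⟨n, rfl⟩ : ∃ k, n = k + 1 := ⟨n - 1, by omega⟩
  rw [sum_evenDegrees]
  split_ifs <;> omega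

/-- Bounds on the tail of `μ` in logarithmic scale. -/
structure TailBounds (τ C g : ℝ) : Prop where
  le : ∀ x : ℝ, 1 ≤ x →
    Real.exp (-(τ - 1) * x - C * x ^ g) ≤ μ.real {d : ℕ | Real.exp x < d}
  ge : ∀ x : ℝ, 1 ≤ x →
    μ.real {d : ℕ | Real.exp x < d} ≤ Real.exp (-(τ - 1) * x + C * x ^ g)

variable {μ}

open Filter Topology

omit [IsProbabilityMeasure μ] in
lemma TailBounds.pos {τ C g : ℝ} (h : TailBounds μ τ C g) {x : ℝ} (hx : 1 ≤ x) :
    0 < μ.real {d : ℕ | Real.exp x < d} := (Real.exp_pos _).trans_le (h.le x hx)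

-- The gain `exp(-(τ - 1)(r - 1) x)` beats the errors of order `x^g`. Hence degrees above a power `r
-- > 1` of the threshold can be discarded, which matters because the lower bound on `p` decreases
-- with the degree.
omit [IsProbabilityMeasure μ] in
lemma TailBounds.eventually_le_mul {τ C g : ℝ} (h : TailBounds μ τ C g) (hτ : 1 < τ) (hg : g < 1)
    {r : ℝ} (hr : 1 < r) {ε : ℝ} (hε : 0 < ε) : ∀ᶠ x : ℝ in atTop,
      μ.real {d : ℕ | Real.exp (r * x) < d} ≤ ε * μ.real {d : ℕ | Real.exp x < d} := by
  have ha : 0 < (τ - 1) * (r - 1) := mul_pos (by linarith) (by linarith)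
  filter_upwards [(tendsto_exp_rpow_sub hg (C * r ^ g + C) ha).eventually (ge_mem_nhds hε),
    eventually_ge_atTop 1] with x hx hx1
  refine (h.ge _ (by nlinarith)).trans (le_trans ?_ (mul_le_mul_of_nonneg_left (h.le x hx1) hε.le))
  refine le_trans (le_of_eq ?_) (mul_le_mul_of_nonneg_right hx (Real.exp_pos _).le)
  rw [← Real.exp_add, Real.mul_rpow (by linarith) (by linarith)]
  ring_nf

/-- The tail at `j` is eventually below `j^(-τ/2)`, summable because `τ > 2`, and the mean is the
sum of the tails. -/
lemma TailBounds.integrable {τ C g : ℝ} (h : TailBounds μ τ C g) (hτ : 2 < τ) (hg : g < 1) :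
    Integrable (fun d : ℕ => (d : ℝ)) μ := by
  have hsum : Summable fun j : ℕ => μ.real {d : ℕ | j < d} := by
    have hs : Summable fun j : ℕ => (j : ℝ) ^ (-(τ / 2)) :=
      Real.summable_nat_rpow.2 (by linarith)
    refine Summable.of_norm_bounded_eventually_nat hs ?_
    have h1 := eventually_rpow_add_le hg C 0 (a := τ / 2 - 1) (by linarith)
    have h2 := (Real.tendsto_log_atTop.comp tendsto_natCast_atTop_atTop).eventually
      (h1.and (eventually_ge_atTop 1))
    filter_upwards [h2, eventually_gt_atTop 0] with j hj hj0
    have hj0' : (0 : ℝ) < j := by exact_mod_cast hj0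
    simp only [Function.comp_apply] at hj
    rw [Real.norm_of_nonneg measureReal_nonneg]
    have h3 := h.ge _ hj.2
    rw [Real.exp_log hj0'] at h3
    simp only [Nat.cast_lt] at h3
    refine h3.trans ?_
    rw [Real.rpow_def_of_pos hj0', Real.exp_le_exp]
    nlinarith [hj.1]
  refine ⟨Measurable.of_discrete.aestronglyMeasurable, ?_⟩
  have hcount : ∀ d : ℕ, (‖(d : ℝ)‖ₑ : ℝ≥0∞) =
      ∑' j : ℕ, ({d : ℕ | j < d} : Set ℕ).indicator (fun _ => (1 : ℝ≥0∞)) d := by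
    intro d
    rw [tsum_eq_sum (s := Finset.range d) (by
      intro j hj
      simp only [Finset.mem_range] at hj
      simp [hj])]
    rw [Finset.sum_congr rfl (g := fun _ => 1) (by
      intro j hj
      simp [Finset.mem_range.1 hj])]
    simp
  rw [HasFiniteIntegral]
  simp_rw [hcount]
  rw [lintegral_tsum (fun j => Measurable.of_discrete.aemeasurable)]
  simp only [lintegral_indicator_const MeasurableSet.of_discrete, one_mul]
  have : ∀ j : ℕ, μ {d : ℕ | j < d} = ENNReal.ofReal (μ.real {d : ℕ | j < d}) := fun j => by simp
  simp_rw [this]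
  rw [← ENNReal.ofReal_tsum_of_nonneg (fun _ => measureReal_nonneg) hsum]
  exact ENNReal.ofReal_lt_top

/-- The tail of `μ` is not eventually halved at every step. -/
lemma TailBounds.exists_le_two_mul {τ C g : ℝ} (h : TailBounds μ τ C g) (hg : g < 1) (K₀ : ℕ) :
    ∃ K ≥ K₀, μ.real {d : ℕ | K ≤ d} ≤ 2 * μ.real {d : ℕ | K + 1 ≤ d} := by
  by_contra! hcon
  -- Halving at every step would make the tail exponentially small, against the lower bound `y^(-τ)`
  -- valid for large `y`.
  have hdecay : ∀ j : ℕ, μ.real {d : ℕ | K₀ + j ≤ d} * 2 ^ j ≤ 1 := by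
    intro j
    induction j with
    | zero => simp
    | succ j ih =>
      have := hcon (K₀ + j) (by omega)
      rw [add_assoc] at this
      rw [pow_succ]
      have h2 : (0 : ℝ) < 2 ^ j := by positivity
      nlinarith
  have h1 := eventually_rpow_add_le hg C 0 (a := 1) one_pos
  have h2 := tendsto_rpow_mul_exp_neg_mul_atTop_nhds_zero τ (Real.log 2) (Real.log_pos (by norm_num))
  have h3 : (0 : ℝ) < (2 : ℝ) ^ (-(K₀ : ℝ)) := by positivity
  have h4 := tendsto_natCast_atTop_atTop.eventually ((h2.eventually (gt_mem_nhds h3)).and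
    (Real.tendsto_log_atTop.eventually (h1.and (eventually_ge_atTop 1))))
  obtain ⟨y, ⟨hy2, hy1, hylog⟩, hyK⟩ := (h4.and (eventually_ge_atTop (K₀ + 1))).exists
  obtain ⟨j, rfl⟩ := Nat.exists_eq_add_of_le (show K₀ ≤ y by omega)
  have hy0 : (0 : ℝ) < ((K₀ + j : ℕ) : ℝ) := by exact_mod_cast (show 0 < K₀ + j by omega)
  have h5 := h.le _ hylog
  rw [Real.exp_log hy0] at h5
  have h6 : μ.real {d : ℕ | ((K₀ + j : ℕ) : ℝ) < d} ≤ μ.real {d : ℕ | K₀ + j ≤ d} :=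
    measureReal_mono fun d hd => by
      have : K₀ + j < d := by exact_mod_cast hd
      exact this.le
  have h7 := hdecay j
  have h8 : ((K₀ + j : ℕ) : ℝ) ^ (-τ) ≤ μ.real {d : ℕ | K₀ + j ≤ d} := by
    refine le_trans ?_ (h5.trans h6)
    rw [Real.rpow_def_of_pos hy0, Real.exp_le_exp]
    nlinarith [hy1]
  have h9 : Real.exp (-Real.log 2 * ((K₀ + j : ℕ) : ℝ)) = 2 ^ (-(K₀ : ℝ)) * (2 ^ j)⁻¹ := by
    rw [← Real.rpow_natCast, ← Real.rpow_neg (by norm_num), ← Real.rpow_add (by norm_num),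
      Real.rpow_def_of_pos (by norm_num)]
    push_cast; ring_nf
  rw [h9] at hy2
  have h10 : ((K₀ + j : ℕ) : ℝ) ^ τ * (2 ^ j)⁻¹ < 1 := by
    have : ((K₀ + j : ℕ) : ℝ) ^ τ * (2 ^ j)⁻¹ * 2 ^ (-(K₀ : ℝ)) < 1 * 2 ^ (-(K₀ : ℝ)) := by
      rw [one_mul]; refine lt_of_eq_of_lt ?_ hy2; ring
    exact lt_of_mul_lt_mul_right this h3.le
  have h11 : ((K₀ + j : ℕ) : ℝ) ^ (-τ) * 2 ^ j ≤ 1 :=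
    (mul_le_mul_of_nonneg_right h8 (by positivity)).trans h7
  rw [Real.rpow_neg hy0.le] at h11
  have h12 : (0 : ℝ) < ((K₀ + j : ℕ) : ℝ) ^ τ := by positivity
  rw [← div_eq_mul_inv, div_lt_one (by positivity)] at h10
  rw [mul_comm, ← div_eq_mul_inv, div_le_one h12] at h11
  linarith

end Degrees

/-! ### Layers of typical degree sequences -/

section Layers

open Filter Topology

/-- For degrees up to a fixed power of `e^x` the percolation costs only a factor `exp(-c' x^g)`. The
constant absorbs `b`, and for `κ ≤ 0` the bound `(log d)^κ ≤ (log 2)^κ`. -/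
lemma exists_exp_le_percolation (p : ℕ → unitInterval) {b c κ g l : ℝ} (hb : 0 < b) (hc : 0 < c)
    (hκg : κ ≤ g) (hl : 0 < l)
    (hpb : ∀ d : ℕ, 2 ≤ d → b * Real.exp (-c * Real.log d ^ κ) < (p d : ℝ)) (hg : 0 < g) :
    ∃ c' : ℝ, 0 ≤ c' ∧ ∀ d : ℕ, 2 ≤ d → ∀ x : ℝ, 1 ≤ x → Real.log d ≤ l * x →
      Real.exp (-(c' * x ^ g)) ≤ p d := by
  have hlog2 : 0 < Real.log 2 := Real.log_pos (by norm_num)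
  refine ⟨|Real.log b| + c * (Real.log 2 ^ κ + l ^ κ), by positivity, fun d hd x hx hdx => ?_⟩
  refine le_trans ?_ (hpb d hd).le
  have hx1 : 1 ≤ x ^ g := Real.one_le_rpow hx hg.le
  have hlog : Real.log 2 ≤ Real.log d :=
    Real.log_le_log (by norm_num) (by exact_mod_cast hd)
  have hpow : Real.log d ^ κ ≤ (Real.log 2 ^ κ + l ^ κ) * x ^ g := by
    have h2 : 0 < Real.log 2 ^ κ := by positivity
    have h3 : 0 < l ^ κ := by positivity
    rcases le_or_gt κ 0 with hκ | hκ
    · have := Real.rpow_le_rpow_of_nonpos hlog2 hlog hκ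
      nlinarith
    · have h1 := Real.rpow_le_rpow (hlog2.le.trans hlog) hdx hκ.le
      rw [Real.mul_rpow hl.le (by linarith)] at h1
      have h4 : x ^ κ ≤ x ^ g := Real.rpow_le_rpow_of_exponent_le hx hκg
      nlinarith
  have hb' : Real.exp (-(|Real.log b| * x ^ g)) ≤ b := by
    rw [← Real.le_log_iff_exp_le hb]
    have := neg_abs_le (Real.log b)
    nlinarith [abs_nonneg (Real.log b)]
  calc Real.exp (-((|Real.log b| + c * (Real.log 2 ^ κ + l ^ κ)) * x ^ g))
      = Real.exp (-(|Real.log b| * x ^ g)) *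
          Real.exp (-(c * ((Real.log 2 ^ κ + l ^ κ) * x ^ g))) := by
        rw [← Real.exp_add]; ring_nf
    _ ≤ b * Real.exp (-c * Real.log d ^ κ) := by
        have := mul_le_mul_of_nonneg_left hpow hc.le
        gcongr
        linarith

/-- Substitute `e^x` for `x`: the error in the exponent becomes `C x · x^(γ-1) = C x^γ ≤ C x^g`. -/
lemma tailBounds_of_distrib {μ : Measure ℕ} [IsProbabilityMeasure μ] {τ γ C g : ℝ} (hC : 0 < C)
    (hγg : γ ≤ g)
    (hlower : ∀ x : ℝ, 1 < x →
      x ^ (-τ + 1 - C * Real.log x ^ (γ - 1)) ≤ 1 - ConfigModel.distrib μ x)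
    (hupper : ∀ x : ℝ, 1 < x →
      1 - ConfigModel.distrib μ x ≤ x ^ (-τ + 1 + C * Real.log x ^ (γ - 1))) :
    TailBounds μ τ C g := by
  have htail : ∀ x : ℝ, 1 - distrib μ x = μ.real {d : ℕ | x < d} := by
    intro x
    have := probReal_compl_eq_one_sub (μ := μ) (s := {d : ℕ | (d : ℝ) ≤ x}) MeasurableSet.of_discrete
    rw [distrib, ← this]
    congr 1
    ext d; simp
  have hpow : ∀ x : ℝ, 1 ≤ x → x * x ^ (γ - 1) ≤ x ^ g := by
    intro x hx
    rw [Real.rpow_sub (by linarith), Real.rpow_one, mul_div_cancel₀ _ (by linarith)]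
    exact Real.rpow_le_rpow_of_exponent_le hx hγg
  constructor
  · intro x hx
    have h := hlower (Real.exp x) (by simp; linarith)
    rw [htail, Real.log_exp, Real.rpow_def_of_pos (Real.exp_pos _), Real.log_exp] at h
    refine le_trans (Real.exp_le_exp.2 ?_) h
    have := mul_le_mul_of_nonneg_left (hpow x hx) hC.le
    linarith
  · intro x hx
    have h := hupper (Real.exp x) (by simp; linarith)
    rw [htail, Real.log_exp, Real.rpow_def_of_pos (Real.exp_pos _), Real.log_exp] at h
    refine h.trans (Real.exp_le_exp.2 ?_)
    have := mul_le_mul_of_nonneg_left (hpow x hx) hC.le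
    linarith

variable {n : ℕ}

lemma sum_evenDegrees_le_of_le {d : Fin n → ℕ} {u v : Fin n} (huv : u ≠ v) {M A : ℝ}
    (hu : d u ≤ A) (hv : d v ≤ A) (hrest : ∑ w ∈ ({u, v} : Finset (Fin n))ᶜ, (d w : ℝ) ≤ M) :
    ∑ w, (evenDegrees d w : ℝ) ≤ M + 2 * A + 1 := by
  have h1 : (∑ w, (evenDegrees d w : ℝ)) ≤ ∑ w, (d w : ℝ) + 1 := by
    exact_mod_cast sum_evenDegrees_le (Fin.pos u) d
  rw [← Finset.sum_add_sum_compl {u, v} fun w => (d w : ℝ), Finset.sum_pair huv] at h1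
  linarith

lemma log_evenDegrees_le {d : Fin n → ℕ} {u : Fin n} {X : ℝ} (hX : 1 ≤ X)
    (hu : (d u : ℝ) ≤ Real.exp (5 / 4 * X)) (hpos : 0 < d u) :
    Real.log (evenDegrees d u) ≤ 2 * X := by
  have h0 : (0 : ℝ) < evenDegrees d u := by
    exact_mod_cast hpos.trans_le (le_evenDegrees d u)
  rw [Real.log_le_iff_le_exp h0]
  have h1 : (evenDegrees d u : ℝ) ≤ d u + 1 := by exact_mod_cast evenDegrees_le d u
  have h2 : Real.exp (2 * X) = Real.exp (5 / 4 * X) * Real.exp (3 / 4 * X) := by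
    rw [← Real.exp_add]; ring_nf
  have h3 : 1 ≤ Real.exp (5 / 4 * X) := Real.one_le_exp (by linarith)
  have h4 : 3 / 4 * X + 1 ≤ Real.exp (3 / 4 * X) := Real.add_one_le_exp _
  have h5 : 3 / 4 * X + 1 ≥ 7 / 4 := by linarith
  have h6 := Real.add_one_le_exp (5 / 4 * X)
  nlinarith

/-- Two vertices of degree at least `K` are directly linked if there are at most `K ^ (5 / 4)`
vertices. -/
lemma exists_real_not_adjacent_le {p : ℕ → unitInterval} {c g l : ℝ} (hg1 : g < 1) (hc : 0 ≤ c)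
    (hl : 2 ≤ l) (hpc : ∀ d : ℕ, 2 ≤ d → ∀ x : ℝ, 1 ≤ x → Real.log d ≤ l * x →
      Real.exp (-(c * x ^ g)) ≤ p d) {δ M : ℝ} (hδ : 0 < δ) (hM : 0 < M) :
    ∃ X₀ : ℝ, ∀ K : ℕ, X₀ ≤ Real.log K → ∀ (n : ℕ) (u v : Fin n), u ≠ v →
      (n : ℝ) ≤ Real.exp (5 / 4 * Real.log K) → ∀ d : Fin n → ℕ, K ≤ d u → K ≤ d v →
      (d u : ℝ) ≤ Real.exp (5 / 4 * Real.log K) → (d v : ℝ) ≤ Real.exp (5 / 4 * Real.log K) →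
      ∑ w ∈ ({u, v} : Finset (Fin n))ᶜ, (d w : ℝ) ≤ M * n →
      ∀ Q, IsPercolationLaw p (evenDegrees d) Q → Q.real {g | ¬ g.edist u v ≤ 1} ≤ δ := by
  have hη : 0 < 1 / (64 * (M + 3)) := by positivity
  obtain ⟨X₀, hX₀⟩ := eventually_atTop.1 ((eventually_rpow_add_le hg1 (2 * c) 0
    (a := 1 / 4) (by norm_num)).and ((eventually_exp_sub_exp_le (1 / (64 * (M + 3))) 0
      (a := 1 / 2) hη (by norm_num) hδ).and (eventually_ge_atTop (16 : ℝ))))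
  refine ⟨X₀, fun K hK n u v huv hn d hu hv hu' hv' hrest Q hQ => ?_⟩
  set X := Real.log K with hX
  obtain ⟨h1, h2, h3⟩ := hX₀ X hK
  have hK0 : (0 : ℝ) < K := by
    rcases Nat.eq_zero_or_pos K with h | h
    · rw [hX, h] at h3; simp at h3; linarith
    · exact_mod_cast h
  have hexpX : Real.exp X = K := Real.exp_log hK0
  have hK16 : (16 : ℝ) ≤ K := by rw [← hexpX]; linarith [Real.add_one_le_exp X]
  have hK2 : 2 ≤ K := by exact_mod_cast (show (2 : ℝ) ≤ K by linarith)
  have hdeg : ∀ {w : Fin n}, K ≤ d w → (d w : ℝ) ≤ Real.exp (5 / 4 * X) →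
      (K : ℝ) ≤ evenDegrees d w ∧ Real.exp (-(c * X ^ g)) ≤ p (evenDegrees d w) := by
    intro w hw hw'
    have hle := hw.trans (le_evenDegrees d w)
    refine ⟨by exact_mod_cast hle, hpc _ (hK2.trans hle) X (by linarith) ?_⟩
    have := log_evenDegrees_le (by linarith) hw' (by omega)
    nlinarith
  have hXg : 0 ≤ X ^ g := Real.rpow_nonneg (by linarith) _
  refine (hQ.real_not_linked_le hK16 (Real.exp_pos _).le (Real.exp_le_one_iff.2 (by
    have := mul_nonneg hc hXg; linarith)) (hdeg hu hu').1 (hdeg hv hv').1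
    (hdeg hu hu').2 (hdeg hv hv').2).trans (le_trans ?_ h2)
  rw [Real.exp_le_exp, zero_mul, zero_sub, neg_le_neg_iff]
  have hL := sum_evenDegrees_le_of_le huv hu' hv' hrest
  have hL' : ∑ w, (evenDegrees d w : ℝ) ≤ (M + 3) * Real.exp (5 / 4 * X) := by
    have h4 : 1 ≤ Real.exp (5 / 4 * X) := Real.one_le_exp (by linarith)
    nlinarith
  have hLpos : 0 < ∑ w, (evenDegrees d w : ℝ) :=
    lt_of_lt_of_le (hK0.trans_le (hdeg hu hu').1)
      (Finset.single_le_sum (f := fun w => (evenDegrees d w : ℝ)) (fun w _ => Nat.cast_nonneg _)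
        (Finset.mem_univ u))
  -- The exponent is `2X` from the two degrees, minus `X / 4` for the percolation, minus `5X / 4`
  -- for the total degree.
  calc 1 / (64 * (M + 3)) * Real.exp (1 / 2 * X)
      ≤ 1 / (64 * (M + 3)) * Real.exp (2 * X - 2 * c * X ^ g - 5 / 4 * X) := by
        gcongr; linarith
    _ = (K : ℝ) ^ 2 * Real.exp (-(c * X ^ g)) ^ 2 /
          (64 * ((M + 3) * Real.exp (5 / 4 * X))) := by
        rw [← hexpX, ← Real.exp_nat_mul, ← Real.exp_nat_mul, Real.exp_sub, sub_eq_add_neg,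
          Real.exp_add]
        push_cast
        rw [show 2 * -(c * X ^ g) = -(2 * c * X ^ g) by ring]
        field_simp
    _ ≤ _ := by gcongr

lemma exp_neg_mul_exp_le {η z : ℝ} (hη : 0 < η) :
    Real.exp (-(η * Real.exp z)) ≤ η⁻¹ * Real.exp (-z) := by
  rw [Real.exp_neg, Real.exp_neg, ← mul_inv]
  exact inv_anti₀ (by positivity) (by linarith [Real.add_one_le_exp (η * Real.exp z)])

set_option maxHeartbeats 1000000 in
open Classical in
/-- If there are more than `K ^ (5 / 4)` vertices, then two vertices of degree at least `K` are
close to each other, for all degree sequences outside of an unlikely set. -/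
lemma exists_real_far_le {μ : Measure ℕ} [IsProbabilityMeasure μ] {τ C g c : ℝ}
    (hτ : 2 < τ) (hτ3 : τ < 3) (hg : 0 < g) (hg1 : g < 1) (hC : 0 ≤ C) (hc : 0 ≤ c)
    (hT : TailBounds μ τ C g) {p : ℕ → unitInterval}
    (hpc : ∀ d : ℕ, 2 ≤ d → ∀ x : ℝ, 1 ≤ x → Real.log d ≤ 4 / (τ - 2) * x →
      Real.exp (-(c * x ^ g)) ≤ p d) {δ M : ℝ} (hδ : 0 < δ) (hM : 0 < M) :
    ∃ X₀ : ℝ, ∀ K : ℕ, X₀ ≤ Real.log K → ∀ (n : ℕ) (u v : Fin n), u ≠ v →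
      Real.exp (5 / 4 * Real.log K) < n →
      ∃ (m : ℕ) (Bad : Set (Fin n → ℕ)),
        (m : ℝ) < Real.log (Real.log n) / |Real.log (τ - 2)| ∧
        (Measure.pi fun _ : Fin n => μ).real Bad ≤ δ ∧
        (∀ x y : Fin n → ℕ, (∀ w ∈ ({u, v} : Finset (Fin n))ᶜ, x w = y w) → x ∈ Bad → y ∈ Bad) ∧
        ∀ d ∉ Bad, K ≤ d u → K ≤ d v → (d u : ℝ) ≤ Real.exp (5 / 4 * Real.log K) →
          (d v : ℝ) ≤ Real.exp (5 / 4 * Real.log K) →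
          ∑ w ∈ ({u, v} : Finset (Fin n))ᶜ, (d w : ℝ) ≤ M * n →
          ∀ Q, IsPercolationLaw p (evenDegrees d) Q →
            Q.real {g | ¬ g.edist u v ≤ (2 * m + 1 : ℕ)} ≤ δ := by
  set θ := τ - 2 with hθdef
  -- `β` is the midpoint of `1/2` and `1/(τ - 1)`, an interval that is nonempty because `τ < 3`.
  have hθ : 0 < θ := by linarith
  have hθ1 : θ < 1 := by linarith
  set β : ℝ := (1 / 2 + 1 / (τ - 1)) / 2 with hβdef
  have hτ1 : 0 < τ - 1 := by linarith
  have hinv : 1 / 2 < 1 / (τ - 1) := one_div_lt_one_div_of_lt hτ1 (by linarith)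
  have hinv1 : 1 / (τ - 1) < 1 := by rw [div_lt_one hτ1]; linarith
  have hβ : 1 / 2 < β := by linarith
  have hβ1 : β ≤ 1 := by linarith
  have hβτ : (τ - 1) * β < 1 := by
    have : β < 1 / (τ - 1) := by linarith
    rw [lt_div_iff₀ hτ1] at this
    linarith
  -- In `B`, `C` pays for the tail, `2 c` for the percolation at both ends of an edge, and 1 leaves
  -- the surplus `exp(x (i + 1) ^ g)`.
  obtain ⟨D, hD, hlayers⟩ := exists_layers (B := C + 2 * c + 1) hθ hθ1 hg hg1 (by positivity) hβ hβ1
  set η : ℝ := 1 / (256 * (M + 3)) with hη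
  have hη0 : 0 < η := by positivity
  have hlogθ : 0 < |Real.log θ| := abs_pos.2 (Real.log_neg hθ hθ1).ne
  obtain ⟨S₀, hS₀⟩ := eventually_atTop.1
    (hT.eventually_le_mul (by linarith) hg1 (r := 5 / 4) (by norm_num) (ε := 1 / 2) (by norm_num))
  -- `S₀` makes the degree windows carry half of the tail, 16 is the minimal degree for the climb,
  -- and the last term bounds the sum of the step failures by `δ / 4`.
  set S : ℝ := max (max S₀ 16) (4 / (η * δ)) with hS
  have hS16 : 16 ≤ S := (le_max_right _ _).trans (le_max_left _ _)
  have hSS₀ : S₀ ≤ S := (le_max_left _ _).trans (le_max_left _ _)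
  have hSδ : 4 / (η * δ) ≤ S := le_max_right _ _
  obtain ⟨X₁, hX₁⟩ := hlayers S (by linarith)
  have ha1 : 0 < (2 * β - 1) / 2 := by linarith
  obtain ⟨N₀, hN₀⟩ := eventually_atTop.1 ((eventually_rpow_add_le hg1 D 0 one_pos).and
    ((eventually_rpow_add_le hg1 (2 * c * 2 ^ g) 0 ha1).and
    ((eventually_exp_sub_exp_le η 2 hη0 ha1 (half_pos hδ)).and
    (eventually_mul_exp_rpow_sub_le hg1 (16 / |Real.log θ|) ((τ - 1) * D + C * 2 ^ g)
      (a := 1 - (τ - 1) * β) (by linarith) hδ))))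
  refine ⟨max (max X₁ N₀) 16, fun K hK n u v huv hn => ?_⟩
  set X := Real.log K with hX
  have hX16 : 16 ≤ X := (le_max_right _ _).trans hK
  have hXX₁ : X₁ ≤ X := (le_max_left _ _).trans ((le_max_left _ _).trans hK)
  have hXN₀ : N₀ ≤ X := (le_max_right _ _).trans ((le_max_left _ _).trans hK)
  have hn0 : (0 : ℝ) < n := (Real.exp_pos _).trans hn
  set N := Real.log n with hN
  have hexpN : Real.exp N = n := Real.exp_log hn0
  have hXN' : 5 / 4 * X < N := (Real.lt_log_iff_exp_lt hn0).2 hn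
  have hXN : X ≤ N := by linarith
  have hN0 : 0 < N := by linarith
  have hn6 : (6 : ℝ) ≤ n := by rw [← hexpN]; linarith [Real.add_one_le_exp N]
  obtain ⟨m, x, hm, hx0, hx0', hxS, hxlog, hxstep, hxm, hxm', hxsum⟩ := hX₁ X hXX₁ N hXN
  obtain ⟨hN1, hN2, hN3, hN4⟩ := hN₀ N (hXN₀.trans hXN)
  have hxmono : Monotone x := monotone_nat_of_le_succ fun i => by
    have := hxlog i; have := Real.log_pos one_lt_two; linarith
  have hx1 : ∀ i, 1 ≤ x i := fun i => by linarith [hxS i]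
  have hxm2 : x m ≤ 2 * N := by linarith [mul_le_of_le_one_left hN0.le hβ1]
  have hxmg : x m ^ g ≤ 2 ^ g * N ^ g := by
    rw [← Real.mul_rpow (by norm_num) hN0.le]
    exact Real.rpow_le_rpow (by linarith [hx1 m]) hxm2 hg.le
  -- Leaving out `u` and `v` makes the bad event independent of their degrees; leaving out the last
  -- vertex avoids the parity correction.
  set W : Finset (Fin n) := {w | w ≠ u ∧ w ≠ v ∧ (w : ℕ) + 1 ≠ n} with hW
  have hWcard : (n : ℝ) / 2 ≤ W.card := by
    have h1 : n ≤ W.card + 3 := by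
      have h2 : (Finset.univ : Finset (Fin n)) ⊆
          W ∪ {u, v, ⟨n - 1, by have := u.2; omega⟩} := by
        intro w _
        simp only [hW, Finset.mem_union, Finset.mem_filter, Finset.mem_univ, true_and,
          Finset.mem_insert, Finset.mem_singleton, Fin.ext_iff]
        omega
      have h3 := (Finset.card_le_card h2).trans (Finset.card_union_le _ _)
      have h4 : ({u, v, ⟨n - 1, by have := u.2; omega⟩} : Finset (Fin n)).card ≤ 3 :=
        Finset.card_le_three
      simp only [Finset.card_univ, Fintype.card_fin] at h3
      omega
    have h2 : (n : ℝ) ≤ W.card + 3 := by exact_mod_cast h1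
    linarith
  have hW0 : (0 : ℝ) < W.card := by linarith
  have hWne : W.Nonempty := Finset.card_pos.1 (by exact_mod_cast hW0)
  -- The degrees of a layer are also bounded above, so that `p` is bounded below on it.
  obtain ⟨I, hI⟩ : ∃ I : ℕ → Set ℕ, ∀ i a,
      a ∈ I i ↔ Real.exp (x i) < a ∧ (a : ℝ) ≤ Real.exp (5 / 4 * x i) :=
    ⟨fun i => {a : ℕ | Real.exp (x i) < a ∧ (a : ℝ) ≤ Real.exp (5 / 4 * x i)}, fun _ _ => Iff.rfl⟩
  have hIT : ∀ i, μ.real {a : ℕ | Real.exp (x i) < a} / 2 ≤ μ.real (I i) := by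
    intro i
    have h1 := hS₀ (x i) (hSS₀.trans (hxS i))
    have h2 : {a : ℕ | Real.exp (x i) < a} ⊆ I i ∪ {a : ℕ | Real.exp (5 / 4 * x i) < a} := by
      intro a ha
      by_cases h : (a : ℝ) ≤ Real.exp (5 / 4 * x i)
      · exact Or.inl ((hI i a).2 ⟨ha, h⟩)
      · exact Or.inr (not_le.1 h)
    have h3 := (measureReal_mono (μ := μ) h2).trans (measureReal_union_le _ _)
    linarith
  have hIpos : ∀ i, 0 < μ.real (I i) := fun i =>
    lt_of_lt_of_le (half_pos (hT.pos (hx1 i))) (hIT i)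
  set bad : ℕ → Set (Fin n → ℕ) := fun i =>
    {d | ((W.filter fun w => d w ∈ I i).card : ℝ) < W.card * μ.real (I i) / 2} with hbad
  refine ⟨m, ⋃ i ∈ Finset.range m, bad (i + 1), hm, ?_, ?_, ?_⟩
  · refine (measureReal_biUnion_finset_le _ _).trans (le_trans ?_ hN4)
    have hterm : ∀ i ∈ Finset.range m, (Measure.pi fun _ : Fin n => μ).real (bad (i + 1)) ≤
        16 * Real.exp (((τ - 1) * D + C * 2 ^ g) * N ^ g - (1 - (τ - 1) * β) * N) := by
      intro i hi
      refine (pi_real_card_lt_le μ W (I (i + 1)) hWne (hIpos _)).trans ?_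
      -- The tail at the top layer is the smallest; there `n` times the tail is still about `n^(1 -
      -- (τ - 1) β)`, which beats the number `m` of layers.
      have h1 : μ.real {a : ℕ | Real.exp (x m) < a} ≤ μ.real {a : ℕ | Real.exp (x (i + 1)) < a} := by
        refine measureReal_mono fun a ha => lt_of_le_of_lt (Real.exp_le_exp.2 (hxmono ?_)) ha
        exact Finset.mem_range.1 hi
      have h2 : Real.exp (-(τ - 1) * x m - C * x m ^ g) / 2 ≤ μ.real (I (i + 1)) := by
        have := hT.le _ (hx1 m)
        have := hIT (i + 1)
        linarith
      have h3 : Real.exp N / 2 * (Real.exp (-(τ - 1) * x m - C * x m ^ g) / 2) ≤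
          W.card * μ.real (I (i + 1)) := by rw [hexpN]; gcongr
      calc 4 / (W.card * μ.real (I (i + 1)))
          ≤ 4 / (Real.exp N / 2 * (Real.exp (-(τ - 1) * x m - C * x m ^ g) / 2)) := by gcongr
        _ = 16 * Real.exp (-(N + (-(τ - 1) * x m - C * x m ^ g))) := by
          rw [Real.exp_neg, Real.exp_add]; field_simp; norm_num
        _ ≤ _ := by
          gcongr
          linarith [mul_le_mul_of_nonneg_left hxm' hτ1.le, mul_le_mul_of_nonneg_left hxmg hC]
    refine (Finset.sum_le_card_nsmul _ _ _ hterm).trans ?_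
    rw [Finset.card_range, nsmul_eq_mul]
    have h1 : (m : ℝ) ≤ N / |Real.log θ| := by
      refine hm.le.trans ?_
      gcongr
      linarith [Real.log_le_sub_one_of_pos hN0]
    calc _ ≤ N / |Real.log θ| * (16 * Real.exp (((τ - 1) * D + C * 2 ^ g) * N ^ g -
          (1 - (τ - 1) * β) * N)) := by gcongr
      _ = _ := by ring
  · intro d d' hdd' hd
    simp only [Set.mem_iUnion, exists_prop, hbad, Set.mem_ofPred_eq] at hd ⊢
    obtain ⟨i, hi, hd⟩ := hd
    refine ⟨i, hi, ?_⟩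
    have : (W.filter fun w => d' w ∈ I (i + 1)) = W.filter fun w => d w ∈ I (i + 1) := by
      refine Finset.filter_congr fun w hw => ?_
      rw [hdd' w]
      simp only [hW, Finset.mem_filter, Finset.mem_univ, true_and] at hw
      simp [hw.1, hw.2.1]
    rwa [this]
  · intro d hd hu hv hu' hv' hrest Q hQ
    simp only [Set.mem_iUnion, exists_prop, hbad, Set.mem_ofPred_eq, not_exists, not_and, not_lt,
      Finset.mem_range] at hd
    have hK0 : (0 : ℝ) < K := by
      rcases Nat.eq_zero_or_pos K with h | h
      · rw [hX, h] at hX16; simp at hX16; linarith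
      · exact_mod_cast h
    have hexpX : Real.exp X = K := Real.exp_log hK0
    have hK16 : (16 : ℝ) ≤ K := by rw [← hexpX]; linarith [Real.add_one_le_exp X]
    have hK2 : 2 ≤ K := by exact_mod_cast (show (2 : ℝ) ≤ K by linarith)
    have h4θ : 4 ≤ 4 / θ := by rw [le_div_iff₀ hθ]; linarith
    set G : ℕ → Finset (Fin n) := fun i =>
      if i = 0 then {u, v} else W.filter fun w => d w ∈ I i with hG
    have hG0 : ∀ w ∈ G 0, Real.exp (x 0) ≤ evenDegrees d w ∧
        Real.exp (-(c * x 0 ^ g)) ≤ p (evenDegrees d w) := by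
      have hdeg : ∀ w : Fin n, K ≤ d w → (d w : ℝ) ≤ Real.exp (5 / 4 * X) →
          Real.exp (x 0) ≤ evenDegrees d w ∧
            Real.exp (-(c * x 0 ^ g)) ≤ p (evenDegrees d w) := by
        intro w hw hw'
        have hle := hw.trans (le_evenDegrees d w)
        have h1 : (K : ℝ) ≤ evenDegrees d w := by exact_mod_cast hle
        refine ⟨?_, hpc _ (hK2.trans hle) _ (hx1 0) ?_⟩
        · exact (Real.exp_le_exp.2 hx0).trans (hexpX.le.trans h1)
        · refine (log_evenDegrees_le (by linarith) hw' (by omega)).trans ?_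
          -- Here `2 X ≤ (4 / θ) x 0` because `x 0 ≥ θ X / 2`; this is the origin of the constant `4
          -- / (τ - 2)`.
          rw [div_mul_eq_mul_div, le_div_iff₀ hθ]
          linarith
      intro w hw
      simp only [hG, if_true, Finset.mem_insert, Finset.mem_singleton] at hw
      rcases hw with rfl | rfl
      · exact hdeg _ hu hu'
      · exact hdeg _ hv hv'
    have hGi : ∀ i, ∀ w ∈ G i, Real.exp (x i) ≤ evenDegrees d w ∧
        Real.exp (-(c * x i ^ g)) ≤ p (evenDegrees d w) := by
      intro i w hw
      rcases Nat.eq_zero_or_pos i with rfl | hi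
      · exact hG0 w hw
      simp only [hG, hi.ne', if_false, Finset.mem_filter, hW, Finset.mem_univ, true_and, hI] at hw
      obtain ⟨⟨-, -, hlast⟩, hw1, hw2⟩ := hw
      rw [evenDegrees_of_ne d hlast]
      have h16 : (2 : ℝ) ≤ d w := by linarith [Real.add_one_le_exp (x i), hx1 i]
      refine ⟨hw1.le, hpc _ (by exact_mod_cast h16) _ (hx1 i) ?_⟩
      rw [Real.log_le_iff_le_exp (by linarith)]
      refine hw2.trans (Real.exp_le_exp.2 ?_)
      exact mul_le_mul_of_nonneg_right (by linarith) (by linarith [hx1 i])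
    have hGcard : ∀ i < m, n * μ.real {a : ℕ | Real.exp (x (i + 1)) < a} / 8 ≤
        (G (i + 1)).card := by
      intro i hi
      have h1 := hd i hi
      have h2 := hIT (i + 1)
      have h3 := hT.pos (hx1 (i + 1))
      have h4 : (n : ℝ) / 2 * (μ.real {a : ℕ | Real.exp (x (i + 1)) < a} / 2) ≤
        W.card * μ.real (I (i + 1)) := by gcongr
      simp only [hG, Nat.succ_ne_zero, if_false]
      linarith
    have hGne : ∀ i < m, (G (i + 1)).Nonempty := by
      intro i hi
      have h1 := hGcard i hi
      have h3 := hT.pos (hx1 (i + 1))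
      have h4 : (0 : ℝ) < (G (i + 1)).card := lt_of_lt_of_le (by positivity) h1
      exact Finset.card_pos.1 (by exact_mod_cast h4)
    have hL : ∑ w, (evenDegrees d w : ℝ) ≤ (M + 3) * n := by
      have := sum_evenDegrees_le_of_le huv hu' hv' hrest
      linarith
    have hLpos : 0 < ∑ w, (evenDegrees d w : ℝ) :=
      lt_of_lt_of_le ((Real.exp_pos _).trans_le (hGi 0 u (by simp [hG])).1)
        (Finset.single_le_sum (f := fun w => (evenDegrees d w : ℝ)) (fun w _ => Nat.cast_nonneg _)
          (Finset.mem_univ u))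
    have hxg : ∀ i, 0 ≤ x i ^ g := fun i => Real.rpow_nonneg (by linarith [hx1 i]) _
    refine (hQ.real_far_le m (fun i => Real.exp (x i)) (fun i => Real.exp (-(c * x i ^ g))) G
      (fun i _ w hw => (hGi i w hw).1) (fun i _ w hw => (hGi i w hw).2)
      (fun i => (Real.exp_pos _).le)
      (fun i => Real.exp_le_one_iff.2 (by have := mul_nonneg hc (hxg i); linarith))
      (by linarith [Real.add_one_le_exp (x 0), hxS 0])
      (fun i _ => ?_) hGne (u := u) (v := v) (by simp [hG]) (by simp [hG])).trans ?_
    · calc 2 * Real.exp (x i) = Real.exp (x i + Real.log 2) := by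
            rw [Real.exp_add, Real.exp_log two_pos, mul_comm]
        _ ≤ _ := Real.exp_le_exp.2 (hxlog i)
    have hsum : ∑ i ∈ Finset.range m, Real.exp (-((G (i + 1)).card * Real.exp (x (i + 1)) *
        Real.exp (x i) * (Real.exp (-(c * x i ^ g)) * Real.exp (-(c * x (i + 1) ^ g))) /
          (32 * ∑ w, (evenDegrees d w : ℝ)))) ≤ δ / 4 := by
      calc _ ≤ ∑ i ∈ Finset.range m, η⁻¹ * Real.exp (-(x (i + 1) ^ g)) := by
            refine Finset.sum_le_sum fun i hi => ?_
            have him := Finset.mem_range.1 hi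
            refine le_trans (Real.exp_le_exp.2 (neg_le_neg ?_)) (exp_neg_mul_exp_le hη0)
            have h1 : Real.exp (x (i + 1) ^ g) ≤ Real.exp (-(τ - 1) * x (i + 1) -
                C * x (i + 1) ^ g) * (Real.exp (x (i + 1)) * Real.exp (x i) *
                  (Real.exp (-(c * x i ^ g)) * Real.exp (-(c * x (i + 1) ^ g)))) := by
              simp only [← Real.exp_add]
              rw [Real.exp_le_exp]
              have h2 := hxstep i
              have h3 : x i ^ g ≤ x (i + 1) ^ g :=
                Real.rpow_le_rpow (by linarith [hx1 i]) (hxmono (Nat.le_succ i)) hg.le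
              have h4 := mul_le_mul_of_nonneg_left h3 hc
              rw [hθdef] at h2
              linarith
            have h2 := hT.le _ (hx1 (i + 1))
            have h3 := hGcard i him
            set Y := Real.exp (x (i + 1)) * Real.exp (x i) *
                  (Real.exp (-(c * x i ^ g)) * Real.exp (-(c * x (i + 1) ^ g))) with hY
            have hY0 : 0 < Y := by positivity
            calc η * Real.exp (x (i + 1) ^ g)
                ≤ η * (μ.real {a : ℕ | Real.exp (x (i + 1)) < a} * Y) := by
                  gcongr
                  exact h1.trans (mul_le_mul_of_nonneg_right h2 hY0.le)
              _ = (n * μ.real {a : ℕ | Real.exp (x (i + 1)) < a} / 8) * Y /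
                    (32 * ((M + 3) * n)) := by
                  rw [hη]; field_simp; ring
              _ ≤ (G (i + 1)).card * Y / (32 * ∑ w, (evenDegrees d w : ℝ)) := by gcongr
              _ = _ := by rw [hY]; ring
        _ = η⁻¹ * ∑ i ∈ Finset.range m, Real.exp (-(x (i + 1) ^ g)) := (Finset.mul_sum ..).symm
        _ ≤ η⁻¹ * (1 / S) := by gcongr
        _ ≤ δ / 4 := by
          rw [div_le_iff₀ (by positivity)] at hSδ
          rw [← one_div, div_mul_div_comm, one_mul, div_le_div_iff₀ (by positivity) (by norm_num)]
          linarith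
    have htop : ((G m).card : ℝ) ^ 2 * Real.exp (-(Real.exp (x m) ^ 2 *
        Real.exp (-(c * x m ^ g)) ^ 2 / (64 * ∑ w, (evenDegrees d w : ℝ)))) ≤ δ / 2 := by
      refine le_trans ?_ hN3
      have h1 : ((G m).card : ℝ) ≤ n := by
        have := Finset.card_le_univ (G m)
        simp only [Fintype.card_fin] at this
        exact_mod_cast this
      -- Two top vertices have degree product at least `n^(2β)` against a total degree of order `n`;
      -- half of the surplus `2β - 1` pays for the percolation. The result beats the union bound
      -- over at most `n^2` pairs.
      have h2 : η * Real.exp ((2 * β - 1) / 2 * N) ≤ Real.exp (x m) ^ 2 *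
          Real.exp (-(c * x m ^ g)) ^ 2 / (64 * ∑ w, (evenDegrees d w : ℝ)) := by
        calc η * Real.exp ((2 * β - 1) / 2 * N)
            ≤ η * Real.exp (2 * x m + 2 * -(c * x m ^ g) - N) := by
              gcongr
              linarith [mul_le_mul_of_nonneg_left hxmg hc]
          _ = (1 / 4) * (Real.exp (x m) ^ 2 * Real.exp (-(c * x m ^ g)) ^ 2 /
                (64 * ((M + 3) * n))) := by
              rw [← Real.exp_nat_mul, ← Real.exp_nat_mul, Real.exp_sub, Real.exp_add, hexpN, hη]
              push_cast
              field_simp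
              norm_num
          _ ≤ 1 * (Real.exp (x m) ^ 2 * Real.exp (-(c * x m ^ g)) ^ 2 /
                (64 * ((M + 3) * n))) := by gcongr; norm_num
          _ ≤ _ := by rw [one_mul]; gcongr
      calc _ ≤ (n : ℝ) ^ 2 * Real.exp (-(η * Real.exp ((2 * β - 1) / 2 * N))) := by
            gcongr
        _ = _ := by
            rw [← hexpN, ← Real.exp_nat_mul, ← Real.exp_add]
            push_cast
            ring_nf
    linarith

end Layers

/-! ### Averaging over the degrees and conditioning -/

section Conclusion

open Filter Topology

variable {μ : Measure ℕ} [IsProbabilityMeasure μ]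

lemma pi_real_le_eval {n : ℕ} {u v : Fin n} (huv : u ≠ v) (K : ℕ) :
    (Measure.pi fun _ : Fin n => μ).real {d | K ≤ d u ∧ K ≤ d v} = μ.real {a | K ≤ a} ^ 2 := by
  rw [pow_two]
  exact pi_real_eval_mem_eval_mem μ huv {a | K ≤ a} {a | K ≤ a}

/-- An event that does not depend on the degrees of `u` and `v` is independent of these degrees
being large. -/
lemma pi_real_le_eval_inter {n : ℕ} {u v : Fin n} (huv : u ≠ v) (K : ℕ) {B : Set (Fin n → ℕ)}
    (hB : ∀ x y : Fin n → ℕ, (∀ w ∈ ({u, v} : Finset (Fin n))ᶜ, x w = y w) → x ∈ B → y ∈ B) :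
    (Measure.pi fun _ : Fin n => μ).real ({d | K ≤ d u ∧ K ≤ d v} ∩ B) =
      μ.real {a | K ≤ a} ^ 2 * (Measure.pi fun _ : Fin n => μ).real B := by
  rw [pi_real_inter_of_disjoint _ (S := {u, v}) (T := {u, v}ᶜ) disjoint_compl_right _ hB,
    pi_real_le_eval huv]
  intro x y h hx
  simpa [← h u (by simp), ← h v (by simp)] using hx

/-- Each of the three irregularities gets conditional probability at most `δ / 3`: degree above
`K^(5/4)` at `u` or at `v` by the tail comparison, a large sum over the other vertices by Markov and
independence. -/
lemma exists_real_irregular_le {τ C g : ℝ} (hτ : 2 < τ) (hg1 : g < 1) (hT : TailBounds μ τ C g)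
    {δ : ℝ} (hδ : 0 < δ) :
    ∃ M : ℝ, 0 < M ∧ ∃ X₀ : ℝ, ∀ K : ℕ, X₀ ≤ Real.log K → ∀ (n : ℕ) (u v : Fin n), u ≠ v →
      (Measure.pi fun _ : Fin n => μ).real ({d | K ≤ d u ∧ K ≤ d v} ∩
        {d | Real.exp (5 / 4 * Real.log K) < d u ∨ Real.exp (5 / 4 * Real.log K) < d v ∨
          M * n < ∑ w ∈ ({u, v} : Finset (Fin n))ᶜ, (d w : ℝ)}) ≤ δ * μ.real {a | K ≤ a} ^ 2 := by
  set E := ∫ d, (d : ℝ) ∂μ with hE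
  have hE0 : 0 ≤ E := integral_nonneg fun d => Nat.cast_nonneg _
  obtain ⟨X₀, hX₀⟩ := eventually_atTop.1 ((hT.eventually_le_mul (by linarith) hg1 (r := 5 / 4)
    (by norm_num) (ε := δ / 3) (by positivity)).and (eventually_gt_atTop (1 : ℝ)))
  refine ⟨3 * (E + 1) / δ, by positivity, X₀, fun K hK n u v huv => ?_⟩
  set X := Real.log K with hX
  obtain ⟨h1, h2⟩ := hX₀ X hK
  have hK0 : (0 : ℝ) < K := by
    rcases Nat.eq_zero_or_pos K with h | h
    · rw [hX, h] at h2; simp at h2; linarith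
    · exact_mod_cast h
  have hexpX : Real.exp X = K := Real.exp_log hK0
  set ρ := μ.real {a | K ≤ a} with hρ
  have hρ0 : 0 ≤ ρ := measureReal_nonneg
  have hn : (0 : ℝ) < n := by exact_mod_cast Fin.pos u
  have hbig : μ.real {a : ℕ | Real.exp (5 / 4 * X) < a} ≤ δ / 3 * ρ := by
    refine h1.trans (mul_le_mul_of_nonneg_left (measureReal_mono fun a ha => ?_) (by positivity))
    have ha' : Real.exp X < a := ha
    rw [hexpX] at ha'
    exact_mod_cast ha'.le
  have hsub : ({d : Fin n → ℕ | K ≤ d u ∧ K ≤ d v} ∩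
        {d | Real.exp (5 / 4 * X) < d u ∨ Real.exp (5 / 4 * X) < d v ∨
          3 * (E + 1) / δ * n < ∑ w ∈ ({u, v} : Finset (Fin n))ᶜ, (d w : ℝ)}) ⊆
      {d | d u ∈ {a : ℕ | Real.exp (5 / 4 * X) < a} ∧ d v ∈ {a | K ≤ a}} ∪
      ({d | d u ∈ {a | K ≤ a} ∧ d v ∈ {a : ℕ | Real.exp (5 / 4 * X) < a}} ∪
      ({d | K ≤ d u ∧ K ≤ d v} ∩
        {d | 3 * (E + 1) / δ * n < ∑ w ∈ ({u, v} : Finset (Fin n))ᶜ, (d w : ℝ)})) := by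
    rintro d ⟨⟨hu, hv⟩, h | h | h⟩
    · exact Or.inl ⟨h, hv⟩
    · exact Or.inr (Or.inl ⟨hu, h⟩)
    · exact Or.inr (Or.inr ⟨⟨hu, hv⟩, h⟩)
  refine (measureReal_mono hsub).trans ((measureReal_union_le _ _).trans (le_trans
    (add_le_add_right (measureReal_union_le _ _) _) ?_))
  rw [pi_real_eval_mem_eval_mem μ huv, pi_real_eval_mem_eval_mem μ huv,
    pi_real_le_eval_inter huv]
  · have h3 := pi_real_lt_sum_le μ (hT.integrable hτ hg1) ({u, v} : Finset (Fin n))ᶜ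
      (M := 3 * (E + 1) / δ * n) (by positivity)
    rw [← hE] at h3
    have h4 : ((({u, v} : Finset (Fin n))ᶜ).card : ℝ) ≤ n := by
      have := Finset.card_le_univ (({u, v} : Finset (Fin n))ᶜ)
      rw [Fintype.card_fin] at this
      exact_mod_cast this
    have h5 : ((({u, v} : Finset (Fin n))ᶜ).card : ℝ) * E / (3 * (E + 1) / δ * n) ≤ δ / 3 := by
      rw [div_le_iff₀ (by positivity)]
      calc ((({u, v} : Finset (Fin n))ᶜ).card : ℝ) * E ≤ n * (E + 1) := by gcongr; linarith
        _ = _ := by field_simp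
    have h6 := mul_le_mul_of_nonneg_left (h3.trans h5) (sq_nonneg ρ)
    have h7 := mul_le_mul_of_nonneg_right hbig hρ0
    change _ * ρ + (ρ * _ + ρ ^ 2 * _) ≤ _
    nlinarith
  · intro x y h hx
    rw [Set.mem_ofPred_eq] at hx ⊢
    have : ∑ w ∈ ({u, v} : Finset (Fin n))ᶜ, (y w : ℝ) =
        ∑ w ∈ ({u, v} : Finset (Fin n))ᶜ, (x w : ℝ) :=
      Finset.sum_congr rfl fun w hw => by rw [h w hw]
    rwa [this]

/-- For all but an unlikely set of degree sequences, two vertices of large degree are likely to be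
closer than `1 + 2 log log n / |log (τ - 2)|`. -/
lemma exists_real_not_near_le {τ C g c : ℝ} (hτ : 2 < τ) (hτ3 : τ < 3) (hg : 0 < g) (hg1 : g < 1)
    (hC : 0 ≤ C) (hc : 0 ≤ c) (hT : TailBounds μ τ C g) {p : ℕ → unitInterval}
    (hpc : ∀ d : ℕ, 2 ≤ d → ∀ x : ℝ, 1 ≤ x → Real.log d ≤ 4 / (τ - 2) * x →
      Real.exp (-(c * x ^ g)) ≤ p d) {δ : ℝ} (hδ : 0 < δ) :
    ∃ X₀ : ℝ, ∀ K : ℕ, X₀ ≤ Real.log K → ∀ n : ℕ, 3 ≤ n → ∀ u v : Fin n, u ≠ v →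
      ∃ (N : ℕ) (Bad : Set (Fin n → ℕ)),
        (N : ℝ) < 1 + 2 * Real.log (Real.log n) / |Real.log (τ - 2)| ∧
        (Measure.pi fun _ : Fin n => μ).real ({d | K ≤ d u ∧ K ≤ d v} ∩ Bad) ≤
          δ * μ.real {a | K ≤ a} ^ 2 ∧
        ∀ d ∉ Bad, K ≤ d u → K ≤ d v → ∀ Q, IsPercolationLaw p (evenDegrees d) Q →
          Q.real {g | ¬ g.edist u v ≤ N} ≤ δ := by
  obtain ⟨M, hM, X₁, hX₁⟩ := exists_real_irregular_le hτ hg1 hT (half_pos hδ)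
  have hl : 2 ≤ 4 / (τ - 2) := by rw [le_div_iff₀ (by linarith)]; linarith
  obtain ⟨X₂, hX₂⟩ := exists_real_not_adjacent_le hg1 hc hl hpc hδ hM
  obtain ⟨X₃, hX₃⟩ := exists_real_far_le hτ hτ3 hg hg1 hC hc hT hpc (half_pos hδ) hM
  refine ⟨max X₁ (max X₂ X₃), fun K hK n hn u v huv => ?_⟩
  have hK1 := hX₁ K ((le_max_left _ _).trans hK) n u v huv
  have hK2 := hX₂ K ((le_max_left _ _).trans ((le_max_right _ _).trans hK)) n u v huv
  have hK3 := hX₃ K ((le_max_right _ _).trans ((le_max_right _ _).trans hK)) n u v huv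
  have hsq := sq_nonneg (μ.real {a | K ≤ a})
  have hloglog : 0 < Real.log (Real.log n) := by
    refine Real.log_pos ((Real.lt_log_iff_exp_lt (by positivity)).2 ?_)
    have : (3 : ℝ) ≤ n := by exact_mod_cast hn
    linarith [Real.exp_one_lt_d9]
  have hlogθ : 0 < |Real.log (τ - 2)| :=
    abs_pos.2 (Real.log_neg (by linarith) (by linarith)).ne
  rcases le_or_gt (n : ℝ) (Real.exp (5 / 4 * Real.log K)) with hsmall | hlarge
  -- Distance 1 suffices for the strict bound, since `log log n > 0` for `n ≥ 3`.
  · refine ⟨1, _, ?_, hK1.trans (by nlinarith), fun d hd hu hv Q hQ => ?_⟩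
    · have : 0 < 2 * Real.log (Real.log n) / |Real.log (τ - 2)| := by positivity
      push_cast; linarith
    · simp only [Set.mem_ofPred_eq, not_or, not_lt] at hd
      simpa using hK2 hsmall d hu hv hd.1 hd.2.1 hd.2.2 Q hQ
  · obtain ⟨m, Bad, hm, hBad, hdep, hfar⟩ := hK3 hlarge
    refine ⟨2 * m + 1, {d | Real.exp (5 / 4 * Real.log K) < d u ∨
      Real.exp (5 / 4 * Real.log K) < d v ∨
        M * n < ∑ w ∈ ({u, v} : Finset (Fin n))ᶜ, (d w : ℝ)} ∪ Bad, ?_, ?_,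
      fun d hd hu hv Q hQ => ?_⟩
    · push_cast
      rw [mul_div_assoc]
      linarith
    · rw [Set.inter_union_distrib_left]
      refine (measureReal_union_le _ _).trans ?_
      rw [pi_real_le_eval_inter huv K hdep]
      nlinarith
    · simp only [Set.mem_union, Set.mem_ofPred_eq, not_or, not_lt] at hd
      exact (hfar d hd.2 hu hv hd.1.1 hd.1.2.1 hd.1.2.2 Q hQ).trans (by linarith)

lemma not_mem_farApart_of_edist_le {τ : ℝ} {n N : ℕ}
    {ω : ((Fin n → ℕ) × SimpleGraph (Fin n)) × (Fin n × Fin n)}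
    (hN : (N : ℝ) < 1 + 2 * Real.log (Real.log n) / |Real.log (τ - 2)|)
    (h : ω.1.2.edist ω.2.1 ω.2.2 ≤ N) : ω ∉ farApart τ n := by
  intro hfar
  obtain ⟨j, hj⟩ := ENat.ne_top_iff_exists.1 (ne_top_of_le_ne_top (ENat.natCast_ne_top N) h)
  rw [← hj] at h
  have hjN : (j : ℝ) ≤ N := by exact_mod_cast h
  simp only [farApart, Set.mem_ofPred_eq, ← hj] at hfar
  have : ((((j : ℕ) : ℕ∞) : ℝ≥0∞) : EReal) = ((j : ℝ) : EReal) := by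
    rw [ENat.toENNReal_coe, ← ENNReal.ofReal_natCast, EReal.coe_ennreal_ofReal,
      max_eq_left (Nat.cast_nonneg j)]
  rw [this, ← EReal.coe_sub, ← EReal.coe_one, EReal.coe_le_coe_iff] at hfar
  linarith

-- The vertices are integrated last, so that all estimates can be made for a fixed pair `(u, v)`.
omit [IsProbabilityMeasure μ] in
lemma jointLaw_apply {n : ℕ} (hn : 0 < n)
    (graphLaw : (Fin n → ℕ) → Measure (SimpleGraph (Fin n)))
    [∀ d, IsZeroOrProbabilityMeasure (graphLaw d)]
    (S : Set (((Fin n → ℕ) × SimpleGraph (Fin n)) × (Fin n × Fin n))) :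
    jointLaw μ n graphLaw S = ∫⁻ y, ∫⁻ d, graphLaw (evenDegrees d)
      {g | ((evenDegrees d, g), y) ∈ S} ∂(Measure.pi fun _ : Fin n => μ)
        ∂(uniformOn (Set.univ : Set (Fin n × Fin n))) := by
  have : NeZero n := ⟨hn.ne'⟩
  have : IsFiniteKernel (Kernel.ofFunOfCountable graphLaw) :=
    ⟨1, ENNReal.one_lt_top, fun a => prob_le_one (μ := graphLaw a)⟩
  rw [jointLaw, Measure.prod_apply_symm MeasurableSet.of_discrete]
  refine lintegral_congr fun y => ?_
  rw [Measure.compProd_apply MeasurableSet.of_discrete, lintegral_map Measurable.of_discrete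
    Measurable.of_discrete]
  rfl

/-- Two vertices of degree at least `k` are unlikely to be far apart, for any percolation law. -/
lemma exists_cond_farApart_le {τ C g c : ℝ} (hτ : 2 < τ) (hτ3 : τ < 3) (hg : 0 < g) (hg1 : g < 1)
    (hC : 0 ≤ C) (hc : 0 ≤ c) (hT : TailBounds μ τ C g) {p : ℕ → unitInterval}
    (hpc : ∀ d : ℕ, 2 ≤ d → ∀ x : ℝ, 1 ≤ x → Real.log d ≤ 4 / (τ - 2) * x →
      Real.exp (-(c * x ^ g)) ≤ p d) {ε : ℝ} (hε : 0 < ε) :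
    ∃ k : ℕ, ∀ n : ℕ, 3 ≤ n → ∀ graphLaw : (Fin n → ℕ) → Measure (SimpleGraph (Fin n)),
      (∀ d, IsPercolationLaw p d (graphLaw d)) →
        (jointLaw μ n graphLaw)[farApart τ n | highDegrees n k] ≤ ENNReal.ofReal ε := by
  obtain ⟨X₀, hX₀⟩ := exists_real_not_near_le hτ hτ3 hg hg1 hC hc hT hpc
    (δ := ε / 8) (by positivity)
  obtain ⟨K₀, hK₀⟩ := eventually_atTop.1
    ((Real.tendsto_log_atTop.comp tendsto_natCast_atTop_atTop).eventually_ge_atTop X₀)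
  obtain ⟨K, hKK₀, hK⟩ := hT.exists_le_two_mul hg1 K₀
  -- Corrected degrees at least `K + 1` force original ones at least `K` and follow from original
  -- ones at least `K + 1`. The two events have probabilities `ρ ^ 2` and `ρ' ^ 2` with `ρ ≤ 2 ρ'`.
  -- The failures total at most `2 (ε / 8) ρ ^ 2 ≤ ε ρ' ^ 2`.
  refine ⟨K + 1, fun n hn graphLaw hlaw => ?_⟩
  have hnear := hX₀ K (hK₀ K hKK₀) n hn
  have hzp : ∀ d, IsZeroOrProbabilityMeasure (graphLaw d) :=
    fun d => (hlaw d).isZeroOrProbabilityMeasure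
  set ν := Measure.pi fun _ : Fin n => μ with hν
  set ρ := μ.real {a | K ≤ a} with hρ
  set ρ' := μ.real {a | K + 1 ≤ a} with hρ'
  have hρ0 : 0 ≤ ρ := measureReal_nonneg
  have hρ0' : 0 ≤ ρ' := measureReal_nonneg
  have hloglog : 0 < Real.log (Real.log n) := by
    refine Real.log_pos ((Real.lt_log_iff_exp_lt (by positivity)).2 ?_)
    have : (3 : ℝ) ≤ n := by exact_mod_cast hn
    linarith [Real.exp_one_lt_d9]
  have hmain : jointLaw μ n graphLaw (highDegrees n (K + 1) ∩ farApart τ n) ≤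
      ENNReal.ofReal ε * jointLaw μ n graphLaw (highDegrees n (K + 1)) := by
    rw [jointLaw_apply (by omega), jointLaw_apply (by omega),
      ← lintegral_const_mul _ Measurable.of_discrete]
    refine lintegral_mono fun y => ?_
    obtain ⟨u, v⟩ := y
    show ∫⁻ d, graphLaw (evenDegrees d) {g | ((evenDegrees d, g), (u, v)) ∈
        highDegrees n (K + 1) ∩ farApart τ n} ∂ν ≤ ENNReal.ofReal ε * ∫⁻ d,
          graphLaw (evenDegrees d) {g | ((evenDegrees d, g), (u, v)) ∈ highDegrees n (K + 1)} ∂ν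
    -- The two uniform vertices may coincide; then the distance is 0 and never too large.
    rcases eq_or_ne u v with rfl | huv
    · have : ∀ d : Fin n → ℕ, {g | ((evenDegrees d, g), (u, u)) ∈
          highDegrees n (K + 1) ∩ farApart τ n} = ∅ := by
        intro d
        refine Set.eq_empty_of_forall_notMem fun g hg => ?_
        refine not_mem_farApart_of_edist_le (N := 0) ?_ (by simp) hg.2
        have : 0 ≤ 2 * Real.log (Real.log n) / |Real.log (τ - 2)| := by positivity
        push_cast; linarith
      simp only [this, measure_empty, lintegral_zero, zero_le]
    obtain ⟨N, Bad, hN, hBad, hgood⟩ := hnear u v huv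
    set A : Set (Fin n → ℕ) := {d | K ≤ d u ∧ K ≤ d v} with hA
    have hνA : ν.real A = ρ ^ 2 := pi_real_le_eval huv K
    have hupper : ∫⁻ d, graphLaw (evenDegrees d) {g | ((evenDegrees d, g), (u, v)) ∈
        highDegrees n (K + 1) ∩ farApart τ n} ∂ν ≤ ENNReal.ofReal (ε / 4 * ρ ^ 2) := by
      calc _ ≤ ∫⁻ d, (A ∩ Bad).indicator 1 d + A.indicator (fun _ => ENNReal.ofReal (ε / 8)) d ∂ν := by
            refine lintegral_mono fun d => ?_
            by_cases hdA : d ∈ A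
            · by_cases hdB : d ∈ Bad
              · rw [Set.indicator_of_mem (show d ∈ A ∩ Bad from ⟨hdA, hdB⟩)]
                exact prob_le_one.trans le_self_add
              · rw [Set.indicator_of_mem hdA]
                refine le_trans ?_ le_add_self
                have h1 := hgood d hdB hdA.1 hdA.2 _ (hlaw (evenDegrees d))
                rw [measureReal_def] at h1
                refine (measure_mono fun g hg => ?_).trans
                  ((ENNReal.le_ofReal_iff_toReal_le (measure_ne_top _ _) (by positivity)).2 h1)
                exact fun hle => not_mem_farApart_of_edist_le (τ := τ) hN
                  (ω := ((evenDegrees d, g), (u, v))) hle hg.2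
            · have : {g | ((evenDegrees d, g), (u, v)) ∈
                  highDegrees n (K + 1) ∩ farApart τ n} = ∅ := by
                refine Set.eq_empty_of_forall_notMem fun g hg => hdA ?_
                have h1 : K + 1 ≤ evenDegrees d u ∧ K + 1 ≤ evenDegrees d v := hg.1
                exact ⟨by have := evenDegrees_le d u; omega,
                  by have := evenDegrees_le d v; omega⟩
              rw [this]; simp
        _ = ENNReal.ofReal (ν.real (A ∩ Bad)) + ENNReal.ofReal (ε / 8) *
              ENNReal.ofReal (ν.real A) := by
            rw [lintegral_add_left Measurable.of_discrete,
              lintegral_indicator_one MeasurableSet.of_discrete,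
              lintegral_indicator_const MeasurableSet.of_discrete]
            simp
        _ ≤ ENNReal.ofReal (ε / 4 * ρ ^ 2) := by
            rw [← ENNReal.ofReal_mul (by positivity),
              ← ENNReal.ofReal_add measureReal_nonneg (by positivity), hνA]
            exact ENNReal.ofReal_le_ofReal (by linarith)
    have hlower : ENNReal.ofReal (ρ' ^ 2) ≤ ∫⁻ d, graphLaw (evenDegrees d)
        {g | ((evenDegrees d, g), (u, v)) ∈ highDegrees n (K + 1)} ∂ν := by
      rw [← pi_real_le_eval huv (K + 1), ofReal_measureReal,
        ← lintegral_indicator_one MeasurableSet.of_discrete]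
      refine lintegral_mono fun d => ?_
      by_cases hd : d ∈ {d : Fin n → ℕ | K + 1 ≤ d u ∧ K + 1 ≤ d v}
      swap
      · rw [Set.indicator_of_notMem hd]; exact zero_le
      have : IsProbabilityMeasure (graphLaw (evenDegrees d)) :=
        (hlaw _).isProbabilityMeasure (even_sum_evenDegrees (by omega) d)
      have h1 : {g | ((evenDegrees d, g), (u, v)) ∈ highDegrees n (K + 1)} = Set.univ :=
        Set.eq_univ_of_forall fun g =>
          ⟨hd.1.trans (le_evenDegrees d u), hd.2.trans (le_evenDegrees d v)⟩
      rw [h1, measure_univ, Set.indicator_of_mem hd, Pi.one_apply]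
    refine hupper.trans (le_trans ?_ (mul_le_mul_right hlower _))
    rw [← ENNReal.ofReal_mul hε.le]
    refine ENNReal.ofReal_le_ofReal ?_
    have : ρ ^ 2 ≤ (2 * ρ') ^ 2 := pow_le_pow_left₀ hρ0 hK 2
    nlinarith
  rw [cond_apply MeasurableSet.of_discrete]
  calc _ ≤ (jointLaw μ n graphLaw (highDegrees n (K + 1)))⁻¹ *
        (ENNReal.ofReal ε * jointLaw μ n graphLaw (highDegrees n (K + 1))) := by gcongr
    _ = ENNReal.ofReal ε * ((jointLaw μ n graphLaw (highDegrees n (K + 1)))⁻¹ *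
          jointLaw μ n graphLaw (highDegrees n (K + 1))) := by ring
    _ ≤ ENNReal.ofReal ε * 1 := by
        gcongr
        exact ENNReal.inv_mul_le_one _
    _ = _ := mul_one _

end Conclusion
end ConfigModel

theorem corollary3p5
    (μ : Measure ℕ) [IsProbabilityMeasure μ]
    (τ γ C : ℝ) (hτ : 2 < τ) (hτ' : τ < 3) (hγ : 0 < γ) (hγ' : γ < 1) (hC : 0 < C)
    (hone : ConfigModel.distrib μ 1 = 0)
    (hlower : ∀ x : ℝ, 1 < x →
      x ^ (-τ + 1 - C * Real.log x ^ (γ - 1)) ≤ 1 - ConfigModel.distrib μ x)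
    (hupper : ∀ x : ℝ, 1 < x →
      1 - ConfigModel.distrib μ x ≤ x ^ (-τ + 1 + C * Real.log x ^ (γ - 1)))
    (p : ℕ → unitInterval) (hp : Antitone p)
    (b c κ : ℝ) (hb : 0 < b) (hc : 0 < c) (hκ : κ < 1)
    (hpb : ∀ d : ℕ, 2 ≤ d → b * Real.exp (-c * Real.log d ^ κ) < (p d : ℝ))
    (ε : ℝ) (hε : 0 < ε) :
    ∃ k : ℕ,
      (⨆ n : ℕ, ⨆ _ : 3 ≤ n,
        (ConfigModel.jointLaw μ n (ConfigModel.halfEdgePercolation p))[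
          ConfigModel.farApart τ n | ConfigModel.highDegrees n k]) < ENNReal.ofReal ε ∧
      (⨆ n : ℕ, ⨆ _ : 3 ≤ n,
        (ConfigModel.jointLaw μ n (ConfigModel.edgePercolation p))[
          ConfigModel.farApart τ n | ConfigModel.highDegrees n k]) < ENNReal.ofReal ε := by
  have hg : 0 < max γ κ := hγ.trans_le (le_max_left _ _)
  have hT := ConfigModel.tailBounds_of_distrib (g := max γ κ) hC (le_max_left _ _) hlower hupper
  obtain ⟨c', hc', hpc⟩ := ConfigModel.exists_exp_le_percolation p (l := 4 / (τ - 2)) hb hc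
    (le_max_right γ κ) (div_pos (by norm_num) (by linarith)) hpb hg
  obtain ⟨k, hk⟩ := ConfigModel.exists_cond_farApart_le hτ hτ' hg (max_lt hγ' hκ) hC.le hc' hT hpc
    (half_pos hε)
  -- A bound by `ε / 2` for each `n` keeps the inequality strict after the supremum.
  have hlt : ENNReal.ofReal (ε / 2) < ENNReal.ofReal ε :=
    (ENNReal.ofReal_lt_ofReal_iff hε).2 (half_lt_self hε)
  refine ⟨k, lt_of_le_of_lt (iSup₂_le fun n hn => ?_) hlt,
    lt_of_le_of_lt (iSup₂_le fun n hn => ?_) hlt⟩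
  · exact hk n hn _ (ConfigModel.isPercolationLaw_halfEdgePercolation p)
  · exact hk n hn _ (ConfigModel.isPercolationLaw_edgePercolation p)
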